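/- Let $d\ge 1$ be an integer, let $s\in(0,1)$ with $d>2s$, let $\gamma\in[0,2s)\cap[0,d-2s]$ and $\gamma_0\in[0,\gamma]$, and let $\rho$ be a measurable weight on $\mathbb{R}^d$ such that, for some constants $0<c<C$, $$c|x|^{-\gamma_0}\le\rho(x)\le C|x|^{-\gamma_0}\ \text{ for a.e. } |x|<1,\qquad c|x|^{-\gamma}\le\rho(x)\le C|x|^{-\gamma}\ \text{ for a.e. } |x|\ge 1 .$$ For $1\le q<\infty$ let $L^q_\rho(\mathbb{R}^d)$ be the $L^q$ space of real functions with respect to the measure $\rho(x)\,dx$. For $\phi\in C_c^\infty(\mathbb{R}^d)$ let $$(-\Delta)^s\phi(x)=C_{d,s}\,\mathrm{p.v.}\!\int_{\mathbb{R}^d}\frac{\phi(x)-\phi(y)}{|x-y|^{d+2s}}\,dy,\qquad C_{d,s}=\frac{s\,4^s\,\Gamma(d/2+s)}{\pi^{d/2}\,\Gamma(1-s)},$$ and for other functions $v$ understand $(-\Delta)^s v$ in the sense of distributions, i.e. $(-\Delta)^s v=f$ means $\int v\,(-\Delta)^s\phi\,dx=\int f\phi\,dx$ for all $\phi\in C_c^\infty(\mathbb{R}^d)$.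 Put $A(v)=\rho^{-1}(-\Delta)^s v$. Let $\dot H^s(\mathbb{R}^d)$ be the closure of $C_c^\infty(\mathbb{R}^d)$ with respect to the norm $\|\phi\|_{\dot H^s}^2=\frac{C_{d,s}}{2}\iint\frac{(\phi(x)-\phi(y))^2}{|x-y|^{d+2s}}\,dx\,dy$, regarded as a space of locally integrable functions (a locally integrable $v$ belongs to it if there are $\phi_n\in C_c^\infty(\mathbb{R}^d)$ with $\|v-\phi_n\|_{\dot H^s}\to0$ and $\phi_n\to v$ in $L^1_{\rm loc}(\mathbb{R}^d)$). Let $p\in\left[2,\frac{2(d-\gamma)}{d-2s}\right)$ and $p'=p/(p-1)$, and let $v,w\in L^p_\rho(\mathbb{R}^d)$ be such that $(-\Delta)^s v$ and $(-\Delta)^s w$ are functions with $A(v),A(w)\in L^{p'}_\rho(\mathbb{R}^d)$. Then $v,w\in\dot H^s(\mathbb{R}^d)$, the integrals below converge absolutely, and $$\int_{\mathbb{R}^d} v\,(-\Delta)^s w\,dx=\int_{\mathbb{R}^d}(-\Delta)^s v\;w\,dx=\frac{C_{d,s}}{2}\int_{\mathbb{R}^d}\int_{\mathbb{R}^d}\frac{(v(x)-v(y))(w(x)-w(y))}{|x-y|^{d+2s}}\,dx\,dy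 .$$ -/

import Mathlib

open MeasureTheory Filter Topology
open scoped ContDiff

noncomputable section

namespace WeightedFracLap

/-- `ℝ^d` with its Euclidean norm and Lebesgue measure. -/
abbrev Rd (d : ℕ) : Type := EuclideanSpace ℝ (Fin d)

/-- The normalizing constant of the fractional Laplacian,
`C_{d,s} = s 4^s Γ(d/2 + s) / (π^(d/2) Γ(1 - s))`, for `0 < s < 1`. -/
def fracConst (d : ℕ) (s : ℝ) : ℝ :=
  s * (4 : ℝ) ^ s * Real.Gamma ((d : ℝ) / 2 + s) /
    (Real.pi ^ ((d : ℝ) / 2) * Real.Gamma (1 - s))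

/-- Test functions: smooth functions with compact support. -/
def IsTest {d : ℕ} (φ : Rd d → ℝ) : Prop :=
  ContDiff ℝ ∞ φ ∧ HasCompactSupport φ

/-- The fractional Laplacian of a test function as a principal value:
`C_{d,s} lim_{ε → 0+} ∫_{|x - y| > ε} (φ x - φ y) / |x - y|^(d + 2s) dy`. -/
def fracLap {d : ℕ} (s : ℝ) (φ : Rd d → ℝ) (x : Rd d) : ℝ :=
  limUnder (𝓝[>] (0 : ℝ)) fun ε : ℝ =>
    fracConst d s *
      ∫ y in {y : Rd d | ε < ‖x - y‖}, (φ x - φ y) / ‖x - y‖ ^ ((d : ℝ) + 2 * s)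

/-- `(-Δ)^s v = f` in the sense of distributions.  It is used only for `v ∈ L^p_ρ` and
`ρ⁻¹ f ∈ L^{p'}_ρ`; then `v`, `f` are locally integrable and both integrals converge absolutely,
since `(-Δ)^s φ` is bounded and `O(|x|^(-d-2s))`. -/
def IsDistribFracLap {d : ℕ} (s : ℝ) (v f : Rd d → ℝ) : Prop :=
  ∀ φ : Rd d → ℝ, IsTest φ → ∫ x, v x * fracLap s φ x = ∫ x, f x * φ x

/-- The two-sided power bounds on the weight `ρ`, with exponent `γ₀` in the unit ball and `γ`
outside of it. -/
structure IsWeight {d : ℕ} (ρ : Rd d → ℝ) (γ₀ γ c C : ℝ) : Prop where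
  aemeasurable : AEMeasurable ρ volume
  c_pos : 0 < c
  c_lt_C : c < C
  inner : ∀ᵐ x : Rd d, ‖x‖ < 1 → c * ‖x‖ ^ (-γ₀) ≤ ρ x ∧ ρ x ≤ C * ‖x‖ ^ (-γ₀)
  outer : ∀ᵐ x : Rd d, 1 ≤ ‖x‖ → c * ‖x‖ ^ (-γ) ≤ ρ x ∧ ρ x ≤ C * ‖x‖ ^ (-γ)

/-- Membership in the weighted Lebesgue space `L^p_ρ`, that is `L^p` of the measure `ρ(x) dx`. -/
def MemLpWeight {d : ℕ} (p : ℝ) (ρ v : Rd d → ℝ) : Prop :=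
  MemLp v (ENNReal.ofReal p) (volume.withDensity fun x => ENNReal.ofReal (ρ x))

/-- The square of the `Ḣ^s` norm, with values in `[0, ∞]`. -/
def hdotNormSq {d : ℕ} (s : ℝ) (v : Rd d → ℝ) : ENNReal :=
  ENNReal.ofReal (fracConst d s / 2) *
    ∫⁻ x, ∫⁻ y, ENNReal.ofReal ((v x - v y) ^ 2 / ‖x - y‖ ^ ((d : ℝ) + 2 * s))

/-- `v ∈ Ḣ^s(ℝ^d)`, the closure of the test functions in the `Ḣ^s` norm.  The elements of the
closure are functions: the approximating sequence also converges to `v` in `L^1_loc`, which fixes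
the additive constant that the seminorm does not see. -/
def MemHdot {d : ℕ} (s : ℝ) (v : Rd d → ℝ) : Prop :=
  LocallyIntegrable v volume ∧
  ∃ φ : ℕ → Rd d → ℝ, (∀ n, IsTest (φ n)) ∧
    Tendsto (fun n => hdotNormSq s (fun x => v x - φ n x)) atTop (𝓝 0) ∧
    ∀ K : Set (Rd d), IsCompact K →
      Tendsto (fun n => ∫⁻ x in K, ‖v x - φ n x‖ₑ) atTop (𝓝 0)

/-- The integrand of the Gagliardo bilinear form. -/
def gagliardoIntegrand {d : ℕ} (s : ℝ) (v w : Rd d → ℝ) (x y : Rd d) : ℝ :=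
  (v x - v y) * (w x - w y) / ‖x - y‖ ^ ((d : ℝ) + 2 * s)

end WeightedFracLap

end

noncomputable section

namespace WeightedFracLap

/-! ### Radial integrals and decay estimates -/

/-! Write `E(v,w)` for the Gagliardo form with its constant `C_{d,s}/2`. For test functions the
formula is Fubini and a symmetrization; the difficulty is that a function in the domain of the
operator is not known in advance to have finite energy. The proof obtains the energy from the
pairing `I = ∫ f v`, where `f = (-Δ)^s v`; this pairing is finite by Hölder's inequality in the
weighted spaces.

Since `p` is below the critical exponent, `v` lies in `L²((1+|x|)^(-2s) dx)`
(`IsWeight.integrable_sq_mul`). Let `u` be a mollification of `v` and `ψ` a cutoff at scale `R`. The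
algebraic identity `(u(x)-u(y)) (ψ²u(x)-ψ²u(y)) = (ψu(x)-ψu(y))² - u(x) u(y) (ψ(x)-ψ(y))²` shows
that `E(ψu,ψu)` is `∫ u (-Δ)^s(ψ²u)` plus a commutator of size at most a constant times `∫ u²
(R+|x|)^(-2s)` (`exists_energy_cutoff_bound`). This tends to zero as `R → ∞` for fixed `u`. Moving
the mollifier onto the test function turns the pairing into `∫ f` times the mollification of `ψ²u`
(`IsDistribFracLap.integral_moll_mul_fracLap`). That mollification converges to `v` in `L^p_ρ`,
because bump averages are bounded there uniformly: the weight is of class `A₁`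
(`IsWeight.exists_lintegral_normed_mul_le`).

Hence there are test functions `φ_n → v` in `L^p_ρ` and almost everywhere with `E(φ_n,φ_n) → I`.
Fatou's lemma gives `E(v,v) ≤ I`, so the weak formulation is available for `v` and `E(v,φ_n) = ∫ f
φ_n → I`. Expanding the square, `E(v-φ_n,v-φ_n) ≤ I - 2E(v,φ_n) + E(φ_n,φ_n) → 0`. So `v` is in the
closure of the test functions, and integration by parts passes from `φ_n` to `v`, by Hölder's
inequality on one side and Cauchy–Schwarz on the other. -/

theorem finrank_Rd (d : ℕ) : Module.finrank ℝ (Rd d) = d := by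
  simp [Rd]

theorem nontrivial_Rd {d : ℕ} (hd : 0 < d) : Nontrivial (Rd d) := by
  apply Module.nontrivial_of_finrank_pos (R := ℝ)
  rw [finrank_Rd]; exact hd

/-- In polar coordinates the radial density is `r^(1-2s)` near zero, integrable because `s < 1`, and
`r^(-1-2s)` at infinity, integrable because `0 < s`. It dominates every singular integral with a
bounded, quadratically vanishing numerator. -/
theorem integrable_min_one_sq_div {d : ℕ} {s : ℝ} (hd : 0 < d) (hs0 : 0 < s) (hs1 : s < 1) :
    Integrable (fun z : Rd d => min 1 (‖z‖ ^ 2) / ‖z‖ ^ ((d : ℝ) + 2 * s)) := by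
  have := nontrivial_Rd hd
  rw [integrable_fun_norm_addHaar (volume : Measure (Rd d))
    (f := fun r : ℝ => min 1 (r ^ 2) / r ^ ((d : ℝ) + 2 * s)), finrank_Rd]
  have key : ∀ y : ℝ, 0 < y → y ^ (d - 1) / y ^ ((d : ℝ) + 2 * s) = y ^ (-1 - 2 * s) := by
    intro y hy
    rw [← Real.rpow_natCast y (d - 1), ← Real.rpow_sub hy]
    congr 1
    rw [Nat.cast_sub (by omega)]; push_cast; ring
  rw [← Set.Ioc_union_Ioi_eq_Ioi (zero_le_one' ℝ)]
  refine IntegrableOn.union ?_ ?_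
  · have : IntegrableOn (fun y : ℝ => y ^ (1 - 2 * s)) (Set.Ioc 0 1) := by
      rw [← intervalIntegrable_iff_integrableOn_Ioc_of_le zero_le_one]
      exact intervalIntegral.intervalIntegrable_rpow' (by linarith)
    refine this.congr_fun ?_ measurableSet_Ioc
    intro y hy
    have hy0 : 0 < y := hy.1
    have h1 : y ^ 2 ≤ 1 := by nlinarith [hy.2]
    simp only [smul_eq_mul]
    have e : y ^ (d - 1) * (y ^ 2 / y ^ ((d : ℝ) + 2 * s)) =
        y ^ (d - 1) / y ^ ((d : ℝ) + 2 * s) * y ^ 2 := by ring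
    rw [min_eq_right h1, e, key y hy0, ← Real.rpow_natCast y 2, ← Real.rpow_add hy0]
    congr 1; push_cast; ring
  · have : IntegrableOn (fun y : ℝ => y ^ (-1 - 2 * s)) (Set.Ioi 1) :=
      integrableOn_Ioi_rpow_of_lt (by linarith) zero_lt_one
    refine this.congr_fun ?_ measurableSet_Ioi
    intro y hy
    have hy1 : 1 < y := hy
    have h1 : 1 ≤ y ^ 2 := by nlinarith
    simp only [smul_eq_mul]
    rw [min_eq_left h1, mul_div_assoc', mul_one, key y (by linarith)]

theorem integrableOn_norm_rpow_neg_closedBall {d : ℕ} {a : ℝ} (hd : 0 < d) (ha : a < d) (R : ℝ) :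
    IntegrableOn (fun z : Rd d => ‖z‖ ^ (-a)) (Metric.closedBall 0 R) := by
  have := nontrivial_Rd hd
  have e : (Metric.closedBall (0 : Rd d) R).indicator (fun z => ‖z‖ ^ (-a)) =
      fun z : Rd d => (Set.Iic R).indicator (fun r : ℝ => r ^ (-a)) ‖z‖ := by
    ext z
    by_cases hz : ‖z‖ ≤ R
    · rw [Set.indicator_of_mem (by simpa using hz), Set.indicator_of_mem (by simpa using hz)]
    · rw [Set.indicator_of_notMem (by simpa using hz), Set.indicator_of_notMem (by simpa using hz)]
  rw [← integrable_indicator_iff Metric.isClosed_closedBall.measurableSet, e,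
    integrable_fun_norm_addHaar (volume : Measure (Rd d))
      (f := (Set.Iic R).indicator (fun r : ℝ => r ^ (-a))), finrank_Rd]
  have : (fun y : ℝ => y ^ (d - 1) • (Set.Iic R).indicator (fun r : ℝ => r ^ (-a)) y) =
      (Set.Iic R).indicator (fun y : ℝ => y ^ (d - 1) * y ^ (-a)) := by
    ext y; by_cases hy : y ∈ Set.Iic R <;> simp [hy]
  rw [this, IntegrableOn, integrable_indicator_iff measurableSet_Iic, IntegrableOn,
    Measure.restrict_restrict measurableSet_Iic, Set.inter_comm, Set.Ioi_inter_Iic]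
  rcases le_or_gt R 0 with hR | hR
  · simp [Set.Ioc_eq_empty (not_lt.mpr hR)]
  have h2 : IntegrableOn (fun y : ℝ => y ^ ((d : ℝ) - 1 - a)) (Set.Ioc 0 R) := by
    rw [← intervalIntegrable_iff_integrableOn_Ioc_of_le hR.le]
    exact intervalIntegral.intervalIntegrable_rpow' (by linarith)
  refine h2.congr_fun ?_ measurableSet_Ioc
  intro y hy
  simp only
  rw [← Real.rpow_natCast y (d - 1), ← Real.rpow_add hy.1]
  congr 1
  rw [Nat.cast_sub (by omega)]; push_cast; ring

/-- Decay of singular integrals whose numerator vanishes quadratically at the origin and is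
supported where one of `x`, `x + z`, `x - z` lies in a fixed ball. -/
theorem exists_decay_bound {d : ℕ} {s : ℝ} (hd : 0 < d) (hs0 : 0 < s) (hs1 : s < 1)
    {R M : ℝ} (hR : 1 ≤ R) (hM : 0 ≤ M) :
    ∃ A, 0 ≤ A ∧ ∀ (x : Rd d) (h : Rd d → ℝ), AEStronglyMeasurable h →
      (∀ z, |h z| ≤ M * min 1 (‖z‖ ^ 2)) →
      (∀ z, R ≤ ‖x‖ → R ≤ ‖x + z‖ → R ≤ ‖x - z‖ → h z = 0) →
      Integrable (fun z => h z / ‖z‖ ^ ((d : ℝ) + 2 * s)) ∧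
      ∫ z, |h z| / ‖z‖ ^ ((d : ℝ) + 2 * s) ≤ A * (1 + ‖x‖) ^ (-((d : ℝ) + 2 * s)) := by
  set r : ℝ := (d : ℝ) + 2 * s with hr
  have hr0 : 0 < r := by positivity
  have hK := integrable_min_one_sq_div hd hs0 hs1
  rw [← hr] at hK
  set K := ∫ z : Rd d, min 1 (‖z‖ ^ 2) / ‖z‖ ^ r with hKdef
  have hK0 : 0 ≤ K := integral_nonneg fun z => by positivity
  set B := volume.real (Metric.ball (0 : Rd d) R) with hB
  have hB0 : 0 ≤ B := measureReal_nonneg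
  -- The first summand serves `|x| < 2R`, where the total integral is enough; the second serves `|x|
  -- ≥ 2R`, where only two balls of volume `B` contribute.
  refine ⟨M * K * (1 + 2 * R) ^ r + 2 * B * M * 4 ^ r, by positivity, ?_⟩
  intro x h hm hle hsupp
  have hmeas : AEStronglyMeasurable (fun z => h z / ‖z‖ ^ r) := by
    have : Measurable fun z : Rd d => ‖z‖ ^ r := by fun_prop
    exact (hm.aemeasurable.div this.aemeasurable).aestronglyMeasurable
  have hdom : ∀ z : Rd d, |h z| / ‖z‖ ^ r ≤ M * (min 1 (‖z‖ ^ 2) / ‖z‖ ^ r) := by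
    intro z
    rw [mul_div_assoc']
    exact div_le_div_of_nonneg_right (hle z) (by positivity)
  have hint : Integrable (fun z => h z / ‖z‖ ^ r) := by
    refine (hK.const_mul M).mono' hmeas (Eventually.of_forall fun z => ?_)
    rw [Real.norm_eq_abs, abs_div, abs_of_nonneg (by positivity : (0 : ℝ) ≤ ‖z‖ ^ r)]
    exact hdom z
  refine ⟨hint, ?_⟩
  have hint' : Integrable (fun z => |h z| / ‖z‖ ^ r) := by
    refine hint.abs.congr (Eventually.of_forall fun z => ?_)
    simp only
    rw [abs_div, abs_of_nonneg (by positivity : (0 : ℝ) ≤ ‖z‖ ^ r)]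
  have hx1 : 0 < 1 + ‖x‖ := by positivity
  rcases lt_or_ge ‖x‖ (2 * R) with hx | hx
  · have h1 : ∫ z, |h z| / ‖z‖ ^ r ≤ M * K := by
      rw [hKdef, ← integral_const_mul]
      exact integral_mono hint' (hK.const_mul M) hdom
    have h2 : 1 ≤ (1 + 2 * R) ^ r * (1 + ‖x‖) ^ (-r) := by
      rw [Real.rpow_neg hx1.le, ← div_eq_mul_inv, one_le_div (by positivity)]
      exact Real.rpow_le_rpow hx1.le (by linarith) hr0.le
    calc _ ≤ M * K := h1
      _ ≤ M * K * ((1 + 2 * R) ^ r * (1 + ‖x‖) ^ (-r)) :=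
        le_mul_of_one_le_right (by positivity) h2
      _ ≤ _ := by
        have h6 : 0 ≤ 2 * B * M * 4 ^ r * (1 + ‖x‖) ^ (-r) := by positivity
        linarith
  · set c := M * (‖x‖ / 2) ^ (-r) with hc
    have hc0 : 0 ≤ c := by positivity
    have hxpos : 0 < ‖x‖ / 2 := by linarith
    have hfar : ∀ z : Rd d, ‖x‖ / 2 ≤ ‖z‖ → |h z| / ‖z‖ ^ r ≤ c := by
      intro z hz
      rw [hc, Real.rpow_neg hxpos.le, ← div_eq_mul_inv]
      apply div_le_div₀ hM _ (by positivity) (Real.rpow_le_rpow hxpos.le hz hr0.le)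
      exact (hle z).trans (mul_le_of_le_one_right hM (min_le_left _ _))
    -- For `|x| ≥ 2R` the numerator lives where `|x+z| < R` or `|x-z| < R`. There `|z| ≥ |x|/2`, so
    -- the kernel is no longer singular.
    have hb : ∀ z, |h z| / ‖z‖ ^ r ≤ (Metric.ball (-x) R).indicator (fun _ => c) z +
        (Metric.ball x R).indicator (fun _ => c) z := by
      intro z
      have n1 : 0 ≤ (Metric.ball (-x) R).indicator (fun _ => c) z :=
        Set.indicator_nonneg (fun _ _ => hc0) z
      have n2 : 0 ≤ (Metric.ball x R).indicator (fun _ => c) z :=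
        Set.indicator_nonneg (fun _ _ => hc0) z
      by_cases h1 : ‖x + z‖ < R
      · have : z ∈ Metric.ball (-x) R := by
          rw [Metric.mem_ball, dist_eq_norm, sub_neg_eq_add, add_comm]; exact h1
        rw [Set.indicator_of_mem this]
        refine (hfar z ?_).trans (by linarith)
        have := norm_sub_le (x + z) z
        rw [add_sub_cancel_right] at this
        linarith
      by_cases h2 : ‖x - z‖ < R
      · have : z ∈ Metric.ball x R := by
          rw [Metric.mem_ball, dist_comm, dist_eq_norm]; exact h2
        rw [Set.indicator_of_mem this]
        refine (hfar z ?_).trans (by linarith)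
        have := norm_add_le (x - z) z
        rw [sub_add_cancel] at this
        linarith
      rw [hsupp z (by linarith) (not_lt.mp h1) (not_lt.mp h2)]
      simp only [abs_zero, zero_div]
      positivity
    have i1 : ∀ y : Rd d, Integrable ((Metric.ball y R).indicator (fun _ : Rd d => c)) := fun y =>
      (integrable_indicator_iff Metric.isOpen_ball.measurableSet).2
        (integrableOn_const (Metric.isBounded_ball.measure_lt_top.ne))
    have i2 : ∀ y : Rd d, ∫ z, (Metric.ball y R).indicator (fun _ : Rd d => c) z = B * c := by
      intro y
      rw [integral_indicator Metric.isOpen_ball.measurableSet, setIntegral_const, smul_eq_mul, hB,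
        measureReal_def, measureReal_def, Measure.addHaar_ball_center]
    have h3 : (‖x‖ / 2) ^ (-r) ≤ 4 ^ r * (1 + ‖x‖) ^ (-r) := by
      have h4 : (4 : ℝ) ^ r = 4⁻¹ ^ (-r) := by
        rw [Real.inv_rpow (by norm_num), Real.rpow_neg (by norm_num), inv_inv]
      rw [h4, ← Real.mul_rpow (by norm_num) hx1.le]
      exact Real.rpow_le_rpow_of_nonpos (by positivity) (by linarith) (by linarith)
    calc _ ≤ ∫ z, ((Metric.ball (-x) R).indicator (fun _ => c) z +
        (Metric.ball x R).indicator (fun _ => c) z) :=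
          integral_mono hint' ((i1 _).add (i1 _)) hb
      _ = 2 * B * c := by
        rw [integral_add (i1 _) (i1 _), i2, i2]; ring
      _ ≤ 2 * B * M * (4 ^ r * (1 + ‖x‖) ^ (-r)) := by
        have h5 : 2 * B * c = 2 * B * M * (‖x‖ / 2) ^ (-r) := by simp only [c]; ring
        rw [h5]
        exact mul_le_mul_of_nonneg_left h3 (by positivity)
      _ ≤ _ := by
        have h6 : 0 ≤ M * K * (1 + 2 * R) ^ r * (1 + ‖x‖) ^ (-r) :=
          mul_nonneg (mul_nonneg (mul_nonneg hM hK0) (by positivity)) (by positivity)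
        linarith

/-! ### The fractional Laplacian of a test function -/

/-- The gradient is Lipschitz, so the first-order Taylor remainder is quadratic by the mean value
inequality; the linear terms at `z` and `-z` cancel. -/
theorem abs_second_diff_le {E : Type*} [NormedAddCommGroup E] [NormedSpace ℝ E] {φ : E → ℝ}
    (h : ContDiff ℝ ∞ φ) (hc : HasCompactSupport φ) :
    ∃ L, 0 ≤ L ∧ ∀ x z, |2 * φ x - φ (x + z) - φ (x - z)| ≤ L * ‖z‖ ^ 2 := by
  have hdiff : Differentiable ℝ φ := h.differentiable (by simp)
  have hf : ContDiff ℝ 1 (fderiv ℝ φ) :=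
    h.fderiv_right (m := 1) (by norm_cast)
  obtain ⟨L, hL⟩ := hf.lipschitzWith_of_hasCompactSupport (hc.fderiv ℝ) (by simp)
  have key : ∀ x z, ‖φ (x + z) - φ x - fderiv ℝ φ x z‖ ≤ L * ‖z‖ ^ 2 := by
    intro x z
    have := (convex_closedBall x ‖z‖).norm_image_sub_le_of_norm_fderiv_le' (𝕜 := ℝ) (f := φ)
      (φ := fderiv ℝ φ x) (C := L * ‖z‖) (x := x) (y := x + z)
      (fun y _ => hdiff y)
      (fun y hy => by
        refine (hL.norm_sub_le y x).trans ?_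
        gcongr
        rwa [← dist_eq_norm])
      (by simp) (by simp)
    rw [add_sub_cancel_left] at this
    rw [pow_two, ← mul_assoc]; exact this
  refine ⟨2 * L, by positivity, fun x z => ?_⟩
  have h1 := key x z
  have h2 := key x (-z)
  rw [norm_neg, map_neg, ← sub_eq_add_neg] at h2
  rw [Real.norm_eq_abs] at h1 h2
  rw [abs_le] at *
  constructor <;> linarith [h1.1, h1.2, h2.1, h2.2]

variable {d : ℕ}

theorem IsTest.exists_bounds {φ : Rd d → ℝ} (hφ : IsTest φ) :
    ∃ R M, 1 ≤ R ∧ 0 ≤ M ∧ (∀ x, R ≤ ‖x‖ → φ x = 0) ∧ (∀ x, |φ x| ≤ M) ∧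
      (∀ x z, |φ x - φ (x + z)| ≤ M * min 1 ‖z‖) ∧
      (∀ x z, |2 * φ x - φ (x + z) - φ (x - z)| ≤ M * min 1 (‖z‖ ^ 2)) := by
  obtain ⟨h, hc⟩ := hφ
  obtain ⟨M₀, hM₀⟩ := hc.exists_bound_of_continuous h.continuous
  obtain ⟨L, hL0, hL⟩ := abs_second_diff_le h hc
  obtain ⟨L', hL'⟩ := h.lipschitzWith_of_hasCompactSupport hc (by simp)
  obtain ⟨R, hR⟩ := hc.isCompact.isBounded.subset_closedBall 0
  have hM₀' : ∀ x, |φ x| ≤ M₀ := hM₀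
  have h0 : 0 ≤ M₀ := (abs_nonneg _).trans (hM₀' 0)
  have hL'0 : (0 : ℝ) ≤ L' := L'.2
  have mm : ∀ {a b t M : ℝ}, 0 ≤ t → a ≤ M → b ≤ M → ∀ u, u ≤ a → u ≤ b * t →
      u ≤ M * min 1 t := by
    intro a b t M ht ha hb u h1 h2
    rcases min_cases 1 t with ⟨h, -⟩ | ⟨h, -⟩ <;> rw [h]
    · linarith
    · exact h2.trans (mul_le_mul_of_nonneg_right hb ht)
  -- One constant for all bounds: `4 * M₀` bounds the first and second differences for large `z`,
  -- while `L'` and `L` bound them for small `z`.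
  refine ⟨max 1 (R + 1), 4 * M₀ + L + L', le_max_left _ _, by positivity, ?_, ?_, ?_, ?_⟩
  · intro x hx
    by_contra hne
    have := hR (subset_tsupport _ hne)
    rw [mem_closedBall_zero_iff] at this
    linarith [le_max_right 1 (R + 1)]
  · intro x; linarith [hM₀' x]
  · intro x z
    refine mm (a := 4 * M₀) (b := L') (norm_nonneg z) (by linarith) (by linarith) _ ?_ ?_
    · have := abs_sub (φ x) (φ (x + z))
      linarith [hM₀' x, hM₀' (x + z)]
    · have := hL'.dist_le_mul x (x + z)
      rwa [Real.dist_eq, dist_self_add_right] at this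
  · intro x z
    refine mm (a := 4 * M₀) (b := L) (by positivity) (by linarith) (by linarith) _ ?_ (hL x z)
    have h1 := abs_le.1 (hM₀' x)
    have h2 := abs_le.1 (hM₀' (x + z))
    have h3 := abs_le.1 (hM₀' (x - z))
    rw [abs_le]
    constructor <;> linarith [h1.1, h1.2, h2.1, h2.2, h3.1, h3.2]

theorem IsTest.continuous {φ : Rd d → ℝ} (hφ : IsTest φ) : Continuous φ := hφ.1.continuous

theorem pos_of_two_mul_lt {s : ℝ} (hs0 : 0 < s) (hd : 2 * s < (d : ℝ)) : 0 < d := by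
  have : (0 : ℝ) < d := by linarith
  exact_mod_cast this

/-- The singular integral defining the fractional Laplacian, with the ball of radius `ε` removed
and without the normalizing constant. -/
def truncFracLap (s : ℝ) (φ : Rd d → ℝ) (ε : ℝ) (x : Rd d) : ℝ :=
  ∫ y in {y : Rd d | ε < ‖x - y‖}, (φ x - φ y) / ‖x - y‖ ^ ((d : ℝ) + 2 * s)

/-- The numerator `φ x - φ (x + z)` cut off to `ε < ‖z‖`. -/
def cutDiff (φ : Rd d → ℝ) (ε : ℝ) (x z : Rd d) : ℝ :=
  {z : Rd d | ε < ‖z‖}.indicator (fun z => φ x - φ (x + z)) z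

theorem measurableSet_lt_norm (ε : ℝ) : MeasurableSet {z : Rd d | ε < ‖z‖} :=
  measurableSet_lt measurable_const measurable_norm

theorem truncFracLap_eq (s : ℝ) (φ : Rd d → ℝ) (ε : ℝ) (x : Rd d) :
    truncFracLap s φ ε x = ∫ z, cutDiff φ ε x z / ‖z‖ ^ ((d : ℝ) + 2 * s) := by
  have hm : MeasurableSet {y : Rd d | ε < ‖x - y‖} :=
    measurableSet_lt measurable_const (by fun_prop)
  rw [truncFracLap, ← integral_indicator hm, ← integral_add_left_eq_self _ x]
  congr 1
  ext z
  have e : x - (x + z) = -z := by abel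
  by_cases hz : ε < ‖z‖
  · rw [cutDiff, Set.indicator_of_mem (by simpa [e] using hz),
      Set.indicator_of_mem (by simpa using hz), e, norm_neg]
  · rw [cutDiff, Set.indicator_of_notMem (by simpa [e] using hz),
      Set.indicator_of_notMem (by simpa using hz), zero_div]

theorem IsTest.aestronglyMeasurable_cutDiff {φ : Rd d → ℝ} (hφ : IsTest φ) (ε : ℝ) (x : Rd d) :
    AEStronglyMeasurable (cutDiff φ ε x) := by
  have := hφ.continuous
  exact ((by fun_prop : Continuous fun z => φ x - φ (x + z)).aestronglyMeasurable).indicator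
    (measurableSet_lt_norm ε)

/-- The constant degenerates as `ε → 0`. This bound only justifies Fubini at fixed `ε`; the limit
rests on the second difference. -/
theorem IsTest.exists_cutDiff_bound {φ : Rd d → ℝ} (hφ : IsTest φ) {s : ℝ} (hd : 0 < d)
    (hs0 : 0 < s) (hs1 : s < 1) {ε : ℝ} (hε : 0 < ε) :
    ∃ A, 0 ≤ A ∧ ∀ x, Integrable (fun z => cutDiff φ ε x z / ‖z‖ ^ ((d : ℝ) + 2 * s)) ∧
      ∫ z, |cutDiff φ ε x z| / ‖z‖ ^ ((d : ℝ) + 2 * s) ≤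
        A * (1 + ‖x‖) ^ (-((d : ℝ) + 2 * s)) := by
  obtain ⟨R, M, hR, hM, h0, hb, h1, h2⟩ := hφ.exists_bounds
  have hε2 : 0 < min 1 (ε ^ 2) := lt_min one_pos (by positivity)
  -- Where `ε < |z|` one has `min 1 (ε²) ≤ min 1 (|z|²)`, so dividing by the former turns a bounded
  -- numerator into one with the required quadratic bound.
  obtain ⟨A, hA, H⟩ := exists_decay_bound hd hs0 hs1 (M := M / min 1 (ε ^ 2)) hR (by positivity)
  refine ⟨A, hA, fun x => H x _ (hφ.aestronglyMeasurable_cutDiff ε x) ?_ ?_⟩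
  · intro z
    rw [cutDiff]
    by_cases hz : ε < ‖z‖
    · rw [Set.indicator_of_mem (by simpa using hz), div_mul_eq_mul_div, mul_div_assoc]
      refine (h1 x z).trans (mul_le_mul_of_nonneg_left ((min_le_left _ _).trans ?_) hM)
      rw [one_le_div hε2]
      gcongr
    · rw [Set.indicator_of_notMem (by simpa using hz), abs_zero]
      positivity
  · intro z a b _
    rw [cutDiff]
    by_cases hz : ε < ‖z‖
    · rw [Set.indicator_of_mem (by simpa using hz), h0 x a, h0 _ b, sub_zero]
    · rw [Set.indicator_of_notMem (by simpa using hz)]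

theorem IsTest.exists_second_diff_bound {φ : Rd d → ℝ} (hφ : IsTest φ) {s : ℝ} (hd : 0 < d)
    (hs0 : 0 < s) (hs1 : s < 1) :
    ∃ A, 0 ≤ A ∧ ∀ x, Integrable (fun z : Rd d =>
        (2 * φ x - φ (x + z) - φ (x - z)) / ‖z‖ ^ ((d : ℝ) + 2 * s)) ∧
      ∫ z, |2 * φ x - φ (x + z) - φ (x - z)| / ‖z‖ ^ ((d : ℝ) + 2 * s) ≤
        A * (1 + ‖x‖) ^ (-((d : ℝ) + 2 * s)) := by
  obtain ⟨R, M, hR, hM, h0, hb, h1, h2⟩ := hφ.exists_bounds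
  obtain ⟨A, hA, H⟩ := exists_decay_bound hd hs0 hs1 (M := M) hR hM
  have := hφ.continuous
  refine ⟨A, hA, fun x => H x _ (Continuous.aestronglyMeasurable (by fun_prop)) (h2 x) ?_⟩
  intro z a b c
  rw [h0 x a, h0 _ b, h0 _ c]; ring

theorem IsTest.exists_sq_diff_bound {φ : Rd d → ℝ} (hφ : IsTest φ) {s : ℝ} (hd : 0 < d)
    (hs0 : 0 < s) (hs1 : s < 1) :
    ∃ A, 0 ≤ A ∧ ∀ x, Integrable (fun z : Rd d =>
        (φ x - φ (x + z)) ^ 2 / ‖z‖ ^ ((d : ℝ) + 2 * s)) ∧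
      ∫ z, (φ x - φ (x + z)) ^ 2 / ‖z‖ ^ ((d : ℝ) + 2 * s) ≤
        A * (1 + ‖x‖) ^ (-((d : ℝ) + 2 * s)) := by
  obtain ⟨R, M, hR, hM, h0, hb, h1, h2⟩ := hφ.exists_bounds
  obtain ⟨A, hA, H⟩ := exists_decay_bound hd hs0 hs1 (M := M ^ 2) hR (by positivity)
  have := hφ.continuous
  refine ⟨A, hA, fun x => ?_⟩
  have := H x (fun z => (φ x - φ (x + z)) ^ 2) (Continuous.aestronglyMeasurable (by fun_prop)) ?_ ?_
  · simpa only [abs_pow, sq_abs] using this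
  · intro z
    rw [abs_pow]
    have h3 : (min 1 ‖z‖) ^ 2 ≤ min 1 (‖z‖ ^ 2) := by
      have : 0 ≤ min 1 ‖z‖ := by positivity
      refine le_min ?_ ?_
      · exact pow_le_one₀ this (min_le_left _ _)
      · exact pow_le_pow_left₀ this (min_le_right _ _) 2
    calc |φ x - φ (x + z)| ^ 2 ≤ (M * min 1 ‖z‖) ^ 2 :=
          pow_le_pow_left₀ (abs_nonneg _) (h1 x z) 2
      _ = M ^ 2 * (min 1 ‖z‖) ^ 2 := by ring
      _ ≤ _ := mul_le_mul_of_nonneg_left h3 (by positivity)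
  · intro z a b _
    simp only [h0 x a, h0 _ b]; ring

/-- The truncated integral converges absolutely, so it may be averaged with its image under `z ↦
-z`. The new numerator is quadratic at the origin, which makes the principal value an absolutely
convergent integral. -/
theorem IsTest.truncFracLap_eq_second_diff {φ : Rd d → ℝ} (hφ : IsTest φ) {s : ℝ} (hd : 0 < d)
    (hs0 : 0 < s) (hs1 : s < 1) {ε : ℝ} (hε : 0 < ε) (x : Rd d) :
    truncFracLap s φ ε x = 1 / 2 * ∫ z, {z : Rd d | ε < ‖z‖}.indicator (fun z =>
      (2 * φ x - φ (x + z) - φ (x - z)) / ‖z‖ ^ ((d : ℝ) + 2 * s)) z := by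
  obtain ⟨A, -, hA⟩ := hφ.exists_cutDiff_bound hd hs0 hs1 hε
  have hi := (hA x).1
  have e1 := truncFracLap_eq s φ ε x
  have e2 := e1
  rw [← integral_neg_eq_self] at e2
  have : truncFracLap s φ ε x + truncFracLap s φ ε x =
      ∫ z, {z : Rd d | ε < ‖z‖}.indicator (fun z =>
      (2 * φ x - φ (x + z) - φ (x - z)) / ‖z‖ ^ ((d : ℝ) + 2 * s)) z := by
    nth_rewrite 1 [e1]
    rw [e2, ← integral_add hi hi.comp_neg]
    congr 1
    ext z
    by_cases hz : ε < ‖z‖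
    · simp only [cutDiff]
      rw [Set.indicator_of_mem (by simpa using hz), Set.indicator_of_mem (by simpa using hz),
        Set.indicator_of_mem (by simpa using hz), norm_neg, ← sub_eq_add_neg]
      ring
    · simp only [cutDiff]
      rw [Set.indicator_of_notMem (by simpa using hz), Set.indicator_of_notMem (by simpa using hz),
        Set.indicator_of_notMem (by simpa using hz)]
      ring
  rw [← this]; ring

/-- The bound is uniform in `ε`, hence a dominating function when `ε → 0` under an integral in `x`.
-/
theorem IsTest.exists_truncFracLap_bound {φ : Rd d → ℝ} (hφ : IsTest φ) {s : ℝ} (hd : 0 < d)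
    (hs0 : 0 < s) (hs1 : s < 1) :
    ∃ A, 0 ≤ A ∧ ∀ ε, 0 < ε → ∀ x,
      |truncFracLap s φ ε x| ≤ A * (1 + ‖x‖) ^ (-((d : ℝ) + 2 * s)) := by
  obtain ⟨A, hA0, hA⟩ := hφ.exists_second_diff_bound hd hs0 hs1
  refine ⟨A, hA0, fun ε hε x => ?_⟩
  rw [hφ.truncFracLap_eq_second_diff hd hs0 hs1 hε]
  have h1 : |∫ z, {z : Rd d | ε < ‖z‖}.indicator (fun z =>
      (2 * φ x - φ (x + z) - φ (x - z)) / ‖z‖ ^ ((d : ℝ) + 2 * s)) z| ≤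
      ∫ z, |2 * φ x - φ (x + z) - φ (x - z)| / ‖z‖ ^ ((d : ℝ) + 2 * s) := by
    rw [← Real.norm_eq_abs]
    refine norm_integral_le_of_norm_le ?_ (Eventually.of_forall fun z => ?_)
    · refine (hA x).1.abs.congr (Eventually.of_forall fun z => ?_)
      simp only
      rw [abs_div, abs_of_nonneg (by positivity : (0 : ℝ) ≤ ‖z‖ ^ ((d : ℝ) + 2 * s))]
    · refine (norm_indicator_le_norm_self _ _).trans ?_
      rw [Real.norm_eq_abs, abs_div,
        abs_of_nonneg (by positivity : (0 : ℝ) ≤ ‖z‖ ^ ((d : ℝ) + 2 * s))]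
  rw [abs_mul, abs_of_pos (by norm_num : (0 : ℝ) < 1 / 2)]
  have h2 := h1.trans (hA x).2
  have : 0 ≤ A * (1 + ‖x‖) ^ (-((d : ℝ) + 2 * s)) := by positivity
  linarith

theorem IsTest.tendsto_truncFracLap {φ : Rd d → ℝ} (hφ : IsTest φ) {s : ℝ} (hd : 0 < d)
    (hs0 : 0 < s) (hs1 : s < 1) (x : Rd d) :
    Tendsto (fun ε => truncFracLap s φ ε x) (𝓝[>] 0) (𝓝 (1 / 2 *
      ∫ z, (2 * φ x - φ (x + z) - φ (x - z)) / ‖z‖ ^ ((d : ℝ) + 2 * s))) := by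
  obtain ⟨A, hA0, hA⟩ := hφ.exists_second_diff_bound hd hs0 hs1
  have key : Tendsto (fun ε => 1 / 2 * ∫ z, {z : Rd d | ε < ‖z‖}.indicator (fun z =>
      (2 * φ x - φ (x + z) - φ (x - z)) / ‖z‖ ^ ((d : ℝ) + 2 * s)) z) (𝓝[>] 0) (𝓝 (1 / 2 *
      ∫ z, (2 * φ x - φ (x + z) - φ (x - z)) / ‖z‖ ^ ((d : ℝ) + 2 * s))) := by
    refine Tendsto.const_mul _ (tendsto_integral_filter_of_dominated_convergence _ ?_ ?_
      (hA x).1.norm ?_)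
    · exact Eventually.of_forall fun ε =>
        (hA x).1.aestronglyMeasurable.indicator (measurableSet_lt_norm ε)
    · exact Eventually.of_forall fun ε => Eventually.of_forall fun z =>
        norm_indicator_le_norm_self _ _
    · refine Eventually.of_forall fun z => ?_
      rcases eq_or_ne z 0 with rfl | hz
      · refine tendsto_const_nhds.congr' (Eventually.of_forall fun ε => ?_)
        simp [Set.indicator_apply]
        intro _; left; ring
      · have : ∀ᶠ ε in 𝓝[>] (0 : ℝ), ε < ‖z‖ :=
          nhdsWithin_le_nhds (Iio_mem_nhds (norm_pos_iff.2 hz))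
        refine tendsto_const_nhds.congr' ?_
        filter_upwards [this] with ε hε
        rw [Set.indicator_of_mem (by simpa using hε)]
  refine key.congr' ?_
  filter_upwards [self_mem_nhdsWithin] with ε hε
  rw [hφ.truncFracLap_eq_second_diff hd hs0 hs1 hε]

theorem IsTest.fracLap_eq {φ : Rd d → ℝ} (hφ : IsTest φ) {s : ℝ} (hd : 0 < d)
    (hs0 : 0 < s) (hs1 : s < 1) (x : Rd d) :
    fracLap s φ x = fracConst d s * (1 / 2 *
      ∫ z, (2 * φ x - φ (x + z) - φ (x - z)) / ‖z‖ ^ ((d : ℝ) + 2 * s)) :=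
  ((hφ.tendsto_truncFracLap hd hs0 hs1 x).const_mul _).limUnder_eq

theorem IsTest.tendsto_mul_truncFracLap {φ : Rd d → ℝ} (hφ : IsTest φ) {s : ℝ} (hd : 0 < d)
    (hs0 : 0 < s) (hs1 : s < 1) (x : Rd d) :
    Tendsto (fun ε => fracConst d s * truncFracLap s φ ε x) (𝓝[>] 0) (𝓝 (fracLap s φ x)) := by
  rw [hφ.fracLap_eq hd hs0 hs1]
  exact (hφ.tendsto_truncFracLap hd hs0 hs1 x).const_mul _

theorem fracConst_pos {s : ℝ} (hs0 : 0 < s) (hs1 : s < 1) : 0 < fracConst d s := by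
  have h1 : 0 < Real.Gamma ((d : ℝ) / 2 + s) := Real.Gamma_pos_of_pos (by positivity)
  have h2 : 0 < Real.Gamma (1 - s) := Real.Gamma_pos_of_pos (by linarith)
  have := Real.pi_pos
  unfold fracConst
  positivity

theorem IsTest.exists_fracLap_bound {φ : Rd d → ℝ} (hφ : IsTest φ) {s : ℝ} (hd : 0 < d)
    (hs0 : 0 < s) (hs1 : s < 1) :
    ∃ A, 0 ≤ A ∧ ∀ x, |fracLap s φ x| ≤ A * (1 + ‖x‖) ^ (-((d : ℝ) + 2 * s)) := by
  obtain ⟨A, hA0, hA⟩ := hφ.exists_truncFracLap_bound hd hs0 hs1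
  have hC := fracConst_pos (d := d) hs0 hs1
  refine ⟨fracConst d s * A, by positivity, fun x => ?_⟩
  refine le_of_tendsto (hφ.tendsto_mul_truncFracLap hd hs0 hs1 x).abs ?_
  filter_upwards [self_mem_nhdsWithin] with ε hε
  rw [abs_mul, abs_of_pos hC, mul_assoc]
  exact mul_le_mul_of_nonneg_left (hA ε hε x) hC.le

theorem IsTest.stronglyMeasurable_fracLap {φ : Rd d → ℝ} (hφ : IsTest φ) {s : ℝ} (hd : 0 < d)
    (hs0 : 0 < s) (hs1 : s < 1) : StronglyMeasurable (fracLap s φ) := by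
  have h : fracLap s φ = fun x => fracConst d s * (1 / 2 *
      ∫ z, (2 * φ x - φ (x + z) - φ (x - z)) / ‖z‖ ^ ((d : ℝ) + 2 * s)) :=
    funext fun x => hφ.fracLap_eq hd hs0 hs1 x
  rw [h]
  have hc := hφ.continuous
  have hm : StronglyMeasurable (fun p : Rd d × Rd d =>
      (2 * φ p.1 - φ (p.1 + p.2) - φ (p.1 - p.2)) / ‖p.2‖ ^ ((d : ℝ) + 2 * s)) := by
    have h1 : Measurable fun p : Rd d × Rd d => 2 * φ p.1 - φ (p.1 + p.2) - φ (p.1 - p.2) :=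
      Continuous.measurable (by fun_prop)
    have h2 : Measurable fun p : Rd d × Rd d => ‖p.2‖ ^ ((d : ℝ) + 2 * s) := by fun_prop
    exact (h1.div h2).stronglyMeasurable
  exact (hm.integral_prod_right'.const_mul _).const_mul _

/-! ### Translation invariance. -/

theorem IsTest.comp_add_right {φ : Rd d → ℝ} (hφ : IsTest φ) (t : Rd d) :
    IsTest (fun x => φ (x + t)) :=
  ⟨hφ.1.comp (contDiff_id.add contDiff_const), hφ.2.comp_homeomorph (Homeomorph.addRight t)⟩

theorem IsTest.fracLap_comp_add_right {φ : Rd d → ℝ} (hφ : IsTest φ) {s : ℝ} (hd : 0 < d)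
    (hs0 : 0 < s) (hs1 : s < 1) (t x : Rd d) :
    fracLap s (fun x => φ (x + t)) x = fracLap s φ (x + t) := by
  rw [(hφ.comp_add_right t).fracLap_eq hd hs0 hs1, hφ.fracLap_eq hd hs0 hs1]
  simp only [add_right_comm _ t, sub_add_eq_add_sub]

/-! ### The Gagliardo form -/

/-- The difference quotient whose `L²` norm is the Gagliardo seminorm. -/
def diffQuot (s : ℝ) (v : Rd d → ℝ) (z : Rd d × Rd d) : ℝ :=
  (v z.1 - v z.2) * ‖z.1 - z.2‖ ^ (-(((d : ℝ) + 2 * s) / 2))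

theorem norm_rpow_half_mul_self {s : ℝ} (hs0 : 0 < s) (x : Rd d) :
    ‖x‖ ^ (-(((d : ℝ) + 2 * s) / 2)) * ‖x‖ ^ (-(((d : ℝ) + 2 * s) / 2)) =
      (‖x‖ ^ ((d : ℝ) + 2 * s))⁻¹ := by
  have h : (0 : ℝ) < (d : ℝ) + 2 * s := by positivity
  -- At the origin both sides are zero by convention: `0 ^ a = 0` for `a ≠ 0`, and `0⁻¹ = 0`.
  rcases eq_or_ne x 0 with rfl | hx
  · rw [norm_zero, Real.zero_rpow h.ne', Real.zero_rpow (by linarith)]; simp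
  · have := norm_pos_iff.2 hx
    rw [← Real.rpow_add this, ← Real.rpow_neg this.le]
    congr 1; ring

theorem diffQuot_mul_diffQuot {s : ℝ} (hs0 : 0 < s) (v w : Rd d → ℝ) (z : Rd d × Rd d) :
    diffQuot s v z * diffQuot s w z = gagliardoIntegrand s v w z.1 z.2 := by
  rw [diffQuot, diffQuot, gagliardoIntegrand,
    div_eq_mul_inv ((v z.1 - v z.2) * (w z.1 - w z.2)), ← norm_rpow_half_mul_self hs0]
  ring

theorem diffQuot_sub (s : ℝ) (v w : Rd d → ℝ) :
    diffQuot s (fun x => v x - w x) = diffQuot s v - diffQuot s w := by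
  ext z; simp only [diffQuot, Pi.sub_apply]; ring

theorem aestronglyMeasurable_diffQuot (s : ℝ) {v : Rd d → ℝ} (hv : AEStronglyMeasurable v) :
    AEStronglyMeasurable (diffQuot s v) (volume.prod volume) := by
  have h1 : Measurable fun z : Rd d × Rd d => ‖z.1 - z.2‖ ^ (-(((d : ℝ) + 2 * s) / 2)) := by
    fun_prop
  exact ((hv.comp_fst).sub (hv.comp_snd)).mul h1.aestronglyMeasurable

theorem hdotNormSq_eq {s : ℝ} (hs0 : 0 < s) {v : Rd d → ℝ} (hv : AEStronglyMeasurable v) :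
    hdotNormSq s v = ENNReal.ofReal (fracConst d s / 2) *
      ∫⁻ z, ENNReal.ofReal (diffQuot s v z ^ 2) ∂(volume.prod volume) := by
  have hm := aestronglyMeasurable_diffQuot s hv
  have hm2 : AEMeasurable (fun z => ENNReal.ofReal (diffQuot s v z ^ 2)) (volume.prod volume) :=
    (hm.pow 2).aemeasurable.ennreal_ofReal
  rw [hdotNormSq, lintegral_prod _ hm2]
  congr 3
  ext x
  congr 1
  ext y
  rw [pow_two (diffQuot s v (x, y)), diffQuot_mul_diffQuot hs0, gagliardoIntegrand, ← pow_two]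

/-- Tonelli with the inner variable recentred at `x`. It reduces double integrals over the product
to the decay in `x` of a singular integral in `z = y - x`. -/
theorem integrable_prod_mul_of_le {a B : Rd d → ℝ} {h : Rd d → Rd d → ℝ}
    (hh : AEStronglyMeasurable (fun p : Rd d × Rd d => h p.1 p.2) (volume.prod volume))
    (hint : ∀ x, Integrable (fun z => h x (x + z)))
    (hB : ∀ x, ∫ z, |h x (x + z)| ≤ B x) (ha : AEStronglyMeasurable a)
    (haB : Integrable (fun x => |a x| * B x)) :
    Integrable (fun p : Rd d × Rd d => a p.1 * h p.1 p.2) (volume.prod volume) ∧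
      ∫ p, |a p.1 * h p.1 p.2| ∂(volume.prod volume) ≤ ∫ x, |a x| * B x := by
  have hm : AEStronglyMeasurable (fun p : Rd d × Rd d => a p.1 * h p.1 p.2)
      (volume.prod volume) := ha.comp_fst.mul hh
  have hint' : ∀ x, Integrable (fun y => h x y) := by
    intro x
    have := (hint x).comp_add_left (-x)
    simpa using this
  have hin : ∀ x, ∫ y, |a x * h x y| = |a x| * ∫ z, |h x (x + z)| := by
    intro x
    rw [integral_add_left_eq_self (fun y => |h x y|) x, ← integral_const_mul]
    simp only [abs_mul]
  have hle : ∀ x, ∫ y, |a x * h x y| ≤ |a x| * B x := by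
    intro x
    rw [hin]
    exact mul_le_mul_of_nonneg_left (hB x) (abs_nonneg _)
  have hI : Integrable (fun x => ∫ y, |a x * h x y|) := by
    refine haB.mono' hm.norm.integral_prod_right' (Eventually.of_forall fun x => ?_)
    rw [Real.norm_eq_abs, abs_of_nonneg (integral_nonneg fun y => abs_nonneg _)]
    exact hle x
  have hP : Integrable (fun p : Rd d × Rd d => a p.1 * h p.1 p.2) (volume.prod volume) :=
    (integrable_prod_iff hm).2 ⟨Eventually.of_forall fun x => (hint' x).const_mul (a x), hI⟩
  refine ⟨hP, ?_⟩
  rw [integral_prod _ hP.abs]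
  exact integral_mono hI haB hle

theorem integrable_one_add_norm_rpow {s : ℝ} (hs0 : 0 < s) :
    Integrable (fun x : Rd d => (1 + ‖x‖) ^ (-((d : ℝ) + 2 * s))) := by
  apply integrable_one_add_norm
  rw [finrank_Rd]; linarith

theorem IsTest.memLp_diffQuot {φ : Rd d → ℝ} (hφ : IsTest φ) {s : ℝ} (hd : 0 < d)
    (hs0 : 0 < s) (hs1 : s < 1) : MemLp (diffQuot s φ) 2 (volume.prod volume) := by
  have hm := aestronglyMeasurable_diffQuot s hφ.continuous.aestronglyMeasurable
  rw [memLp_two_iff_integrable_sq hm]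
  obtain ⟨A, hA0, hA⟩ := hφ.exists_sq_diff_bound hd hs0 hs1
  have e : ∀ x y : Rd d, diffQuot s φ (x, y) ^ 2 =
      (φ x - φ y) ^ 2 / ‖x - y‖ ^ ((d : ℝ) + 2 * s) := by
    intro x y
    rw [pow_two, diffQuot_mul_diffQuot hs0, gagliardoIntegrand, ← pow_two]
  have e2 : ∀ x z : Rd d, diffQuot s φ (x, x + z) ^ 2 =
      (φ x - φ (x + z)) ^ 2 / ‖z‖ ^ ((d : ℝ) + 2 * s) := by
    intro x z
    rw [e, sub_add_cancel_left, norm_neg]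
  have := (integrable_prod_mul_of_le (a := fun _ => 1)
    (B := fun x => A * (1 + ‖x‖) ^ (-((d : ℝ) + 2 * s)))
    (h := fun x y => diffQuot s φ (x, y) ^ 2) (hm.pow 2)
    (fun x => by simpa only [e2] using (hA x).1)
    (fun x => by
      simp only [abs_pow, sq_abs]
      simp only [e2]
      exact (hA x).2)
    aestronglyMeasurable_const
    (by simpa using (integrable_one_add_norm_rpow hs0).const_mul A)).1
  simpa using this

/-- The weak form of the fractional Laplacian of a test function. -/
theorem IsTest.integral_mul_fracLap {φ : Rd d → ℝ} (hφ : IsTest φ) {s : ℝ} (hd : 0 < d)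
    (hs0 : 0 < s) (hs1 : s < 1) {u : Rd d → ℝ} (hu : AEStronglyMeasurable u)
    (hu1 : Integrable (fun x => |u x| * (1 + ‖x‖) ^ (-((d : ℝ) + 2 * s))))
    (hG : Integrable (fun z : Rd d × Rd d => gagliardoIntegrand s u φ z.1 z.2)
      (volume.prod volume)) :
    ∫ x, u x * fracLap s φ x =
      fracConst d s / 2 * ∫ z, gagliardoIntegrand s u φ z.1 z.2 ∂(volume.prod volume) := by
  have hφc := hφ.continuous
  set S : ℝ → Set (Rd d × Rd d) := fun ε => {z | ε < ‖z.2 - z.1‖} with hS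
  have hSm : ∀ ε, MeasurableSet (S ε) := fun ε =>
    measurableSet_lt measurable_const (by fun_prop)
  -- Away from the diagonal everything is integrable, so Fubini applies. The kernel `h` is
  -- antisymmetric, and averaging with the swapped integral replaces `u x` by half of `u x - u y`.
  have hcont : ∀ ε : ℝ, 0 < ε → ∫ x, u x * truncFracLap s φ ε x =
      1 / 2 * ∫ z, (S ε).indicator (fun z => gagliardoIntegrand s u φ z.1 z.2) z
        ∂(volume.prod volume) := by
    intro ε hε
    obtain ⟨A, hA0, hA⟩ := hφ.exists_cutDiff_bound hd hs0 hs1 hε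
    let h : Rd d → Rd d → ℝ := fun x y => cutDiff φ ε x (y - x) / ‖y - x‖ ^ ((d : ℝ) + 2 * s)
    have hS' : ∀ x y : Rd d, h x y =
        (S ε).indicator (fun z => (φ z.1 - φ z.2) / ‖z.2 - z.1‖ ^ ((d : ℝ) + 2 * s)) (x, y) := by
      intro x y
      by_cases hz : ε < ‖y - x‖
      · rw [Set.indicator_of_mem (by simpa [S] using hz)]
        simp only [h, cutDiff]
        rw [Set.indicator_of_mem (by simpa using hz), add_sub_cancel]
      · rw [Set.indicator_of_notMem (by simpa [S] using hz)]
        simp only [h, cutDiff]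
        rw [Set.indicator_of_notMem (by simpa using hz), zero_div]
    have hhm : AEStronglyMeasurable (fun p : Rd d × Rd d => h p.1 p.2) (volume.prod volume) := by
      simp only [hS']
      refine AEStronglyMeasurable.indicator ?_ (hSm ε)
      have h1 : Measurable fun z : Rd d × Rd d => φ z.1 - φ z.2 :=
        Continuous.measurable (by fun_prop)
      exact (h1.div (by fun_prop)).aestronglyMeasurable
    have hP := (integrable_prod_mul_of_le (a := u)
      (B := fun x => A * (1 + ‖x‖) ^ (-((d : ℝ) + 2 * s))) (h := h) hhm
      (fun x => by simpa only [h, add_sub_cancel_left] using (hA x).1)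
      (fun x => by
        simp only [h, add_sub_cancel_left]
        refine le_of_eq_of_le ?_ (hA x).2
        congr 1; ext z
        rw [abs_div, abs_of_nonneg (by positivity : (0 : ℝ) ≤ ‖z‖ ^ ((d : ℝ) + 2 * s))])
      hu
      (by
        refine (hu1.const_mul A).congr (Eventually.of_forall fun x => ?_)
        simp only; ring)).1
    have e1 : ∫ x, u x * truncFracLap s φ ε x =
        ∫ z, u z.1 * h z.1 z.2 ∂(volume.prod volume) := by
      rw [integral_prod _ hP]
      congr 1; ext x
      rw [truncFracLap_eq, ← integral_const_mul,
        ← integral_add_left_eq_self (fun y => u x * h x y) x]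
      simp only [h, add_sub_cancel_left]
    have e2 : ∫ z, u z.1 * h z.1 z.2 ∂(volume.prod volume) =
        ∫ z, u z.2 * h z.2 z.1 ∂(volume.prod volume) :=
      (integral_prod_swap (fun z : Rd d × Rd d => u z.1 * h z.1 z.2)).symm
    have e3 : ∫ z, u z.1 * h z.1 z.2 ∂(volume.prod volume) +
        ∫ z, u z.2 * h z.2 z.1 ∂(volume.prod volume) =
        ∫ z, (S ε).indicator (fun z => gagliardoIntegrand s u φ z.1 z.2) z
          ∂(volume.prod volume) := by
      have hP' : Integrable (fun z : Rd d × Rd d => u z.2 * h z.2 z.1) (volume.prod volume) :=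
        hP.swap
      rw [← integral_add hP hP']
      congr 1; ext ⟨x, y⟩
      simp only [hS']
      by_cases hz : ε < ‖y - x‖
      · rw [Set.indicator_of_mem (by simpa [S] using hz),
          Set.indicator_of_mem (by simpa [S, norm_sub_rev] using hz),
          Set.indicator_of_mem (by simpa [S] using hz)]
        simp only [gagliardoIntegrand]
        rw [norm_sub_rev y x]
        ring
      · rw [Set.indicator_of_notMem (by simpa [S] using hz),
          Set.indicator_of_notMem (by simpa [S, norm_sub_rev] using hz),
          Set.indicator_of_notMem (by simpa [S] using hz)]
        ring
    rw [← e3, ← e2, ← e1]; ring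
  obtain ⟨A, hA0, hA⟩ := hφ.exists_truncFracLap_bound hd hs0 hs1
  have hC := fracConst_pos (d := d) hs0 hs1
  have hmt : ∀ ε, AEStronglyMeasurable (fun x => truncFracLap s φ ε x) := by
    intro ε
    have h1 : Measurable fun p : Rd d × Rd d =>
        cutDiff φ ε p.1 p.2 / ‖p.2‖ ^ ((d : ℝ) + 2 * s) := by
      have h2 : Measurable fun p : Rd d × Rd d => φ p.1 - φ (p.1 + p.2) :=
        Continuous.measurable (by fun_prop)
      have h3 : (fun p : Rd d × Rd d => cutDiff φ ε p.1 p.2) =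
          {p : Rd d × Rd d | ε < ‖p.2‖}.indicator fun p => φ p.1 - φ (p.1 + p.2) := by
        ext p; rfl
      have h4 : Measurable fun p : Rd d × Rd d => cutDiff φ ε p.1 p.2 := by
        rw [h3]
        exact h2.indicator (measurableSet_lt measurable_const (by fun_prop))
      exact h4.div (by fun_prop)
    simp only [truncFracLap_eq]
    exact h1.stronglyMeasurable.integral_prod_right'.aestronglyMeasurable
  have T1 : Tendsto (fun ε => ∫ x, u x * (fracConst d s * truncFracLap s φ ε x)) (𝓝[>] 0)
      (𝓝 (∫ x, u x * fracLap s φ x)) := by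
    refine tendsto_integral_filter_of_dominated_convergence
      (fun x => fracConst d s * A * (|u x| * (1 + ‖x‖) ^ (-((d : ℝ) + 2 * s)))) ?_ ?_
      (hu1.const_mul _) ?_
    · exact Eventually.of_forall fun ε => hu.mul ((hmt ε).const_mul _)
    · filter_upwards [self_mem_nhdsWithin] with ε hε
      refine Eventually.of_forall fun x => ?_
      rw [Real.norm_eq_abs, abs_mul, abs_mul, abs_of_pos hC]
      calc |u x| * (fracConst d s * |truncFracLap s φ ε x|) ≤
          |u x| * (fracConst d s * (A * (1 + ‖x‖) ^ (-((d : ℝ) + 2 * s)))) := by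
            gcongr; exact hA ε hε x
        _ = _ := by ring
    · exact Eventually.of_forall fun x =>
        (hφ.tendsto_mul_truncFracLap hd hs0 hs1 x).const_mul _
  have T2 : Tendsto (fun ε => fracConst d s / 2 *
      ∫ z, (S ε).indicator (fun z => gagliardoIntegrand s u φ z.1 z.2) z ∂(volume.prod volume))
      (𝓝[>] 0) (𝓝 (fracConst d s / 2 *
        ∫ z, gagliardoIntegrand s u φ z.1 z.2 ∂(volume.prod volume))) := by
    refine Tendsto.const_mul _ (tendsto_integral_filter_of_dominated_convergence _ ?_ ?_
      hG.norm ?_)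
    · exact Eventually.of_forall fun ε => hG.aestronglyMeasurable.indicator (hSm ε)
    · exact Eventually.of_forall fun ε => Eventually.of_forall fun z =>
        norm_indicator_le_norm_self _ _
    · refine Eventually.of_forall fun z => ?_
      -- On the diagonal the integrand itself is zero, so the cutoff does not matter; off it the
      -- indicator is eventually one.
      rcases eq_or_ne z.2 z.1 with hz | hz
      · refine tendsto_const_nhds.congr' (Eventually.of_forall fun ε => ?_)
        simp only
        by_cases h : z ∈ S ε
        · rw [Set.indicator_of_mem h]
        · rw [Set.indicator_of_notMem h, gagliardoIntegrand, hz]; simp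
      · have : ∀ᶠ ε in 𝓝[>] (0 : ℝ), ε < ‖z.2 - z.1‖ :=
          nhdsWithin_le_nhds (Iio_mem_nhds (norm_pos_iff.2 (sub_ne_zero.2 hz)))
        refine tendsto_const_nhds.congr' ?_
        filter_upwards [this] with ε hε
        rw [Set.indicator_of_mem (by simpa [S] using hε)]
  refine tendsto_nhds_unique T1 (T2.congr' ?_)
  filter_upwards [self_mem_nhdsWithin] with ε hε
  have := hcont ε hε
  simp only [mul_left_comm (u _)]
  rw [integral_const_mul, this]
  ring

theorem integrable_gagliardoIntegrand {s : ℝ} (hs0 : 0 < s) {v w : Rd d → ℝ}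
    (hv : MemLp (diffQuot s v) 2 (volume.prod volume))
    (hw : MemLp (diffQuot s w) 2 (volume.prod volume)) :
    Integrable (fun z : Rd d × Rd d => gagliardoIntegrand s v w z.1 z.2) (volume.prod volume) := by
  refine (hv.integrable_mul hw).congr (Eventually.of_forall fun z => ?_)
  exact diffQuot_mul_diffQuot hs0 v w z

/-! ### Power weights -/

/-- The measure `ρ(x) dx`. -/
abbrev wMeasure (ρ : Rd d → ℝ) : Measure (Rd d) :=
  volume.withDensity fun x => ENNReal.ofReal (ρ x)

theorem ae_ne_zero_Rd (hd : 0 < d) : ∀ᵐ x : Rd d, x ≠ 0 := by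
  have := nontrivial_Rd hd
  exact Measure.ae_ne volume (0 : Rd d)

section Weight

variable {ρ : Rd d → ℝ} {γ₀ γ c C : ℝ}

/-- Because `γ₀ ≤ γ`, the smaller of the two powers is the inner one for `|x| < 1` and the outer one
for `|x| ≥ 1`, so both regimes become one formula. -/
theorem IsWeight.ae_bounds (hρ : IsWeight ρ γ₀ γ c C) (hd : 0 < d) (h01 : γ₀ ≤ γ) :
    ∀ᵐ x, c * min (‖x‖ ^ (-γ₀)) (‖x‖ ^ (-γ)) ≤ ρ x ∧
      ρ x ≤ C * min (‖x‖ ^ (-γ₀)) (‖x‖ ^ (-γ)) := by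
  filter_upwards [hρ.inner, hρ.outer, ae_ne_zero_Rd hd] with x h1 h2 h3
  have hx := norm_pos_iff.2 h3
  rcases lt_or_ge ‖x‖ 1 with h | h
  · rw [min_eq_left (Real.rpow_le_rpow_of_exponent_ge hx h.le (by linarith))]
    exact h1 h
  · rw [min_eq_right (Real.rpow_le_rpow_of_exponent_le h (by linarith))]
    exact h2 h

theorem IsWeight.ae_lower (hρ : IsWeight ρ γ₀ γ c C) (hd : 0 < d) (h0 : 0 ≤ γ₀) (h01 : γ₀ ≤ γ) :
    ∀ᵐ x, c * (1 + ‖x‖) ^ (-γ) ≤ ρ x := by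
  filter_upwards [hρ.ae_bounds hd h01, ae_ne_zero_Rd hd] with x h1 h3
  have hx := norm_pos_iff.2 h3
  refine le_trans (mul_le_mul_of_nonneg_left (le_min ?_ ?_) hρ.c_pos.le) h1.1
  · refine (Real.rpow_le_rpow_of_exponent_le (by linarith) (neg_le_neg h01)).trans ?_
    exact Real.rpow_le_rpow_of_nonpos hx (by linarith) (by linarith)
  · exact Real.rpow_le_rpow_of_nonpos hx (by linarith) (by linarith)

theorem IsWeight.ae_pos (hρ : IsWeight ρ γ₀ γ c C) (hd : 0 < d) (h0 : 0 ≤ γ₀) (h01 : γ₀ ≤ γ) :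
    ∀ᵐ x, 0 < ρ x := by
  filter_upwards [hρ.ae_lower hd h0 h01] with x hx
  have := hρ.c_pos
  exact lt_of_lt_of_le (by positivity) hx

theorem IsWeight.C_pos (hρ : IsWeight ρ γ₀ γ c C) : 0 < C := hρ.c_pos.trans hρ.c_lt_C

theorem IsWeight.aemeasurable_ofReal (hρ : IsWeight ρ γ₀ γ c C) :
    AEMeasurable fun x => ENNReal.ofReal (ρ x) := hρ.aemeasurable.ennreal_ofReal

theorem IsWeight.volume_absolutelyContinuous (hρ : IsWeight ρ γ₀ γ c C) (hd : 0 < d)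
    (h0 : 0 ≤ γ₀) (h01 : γ₀ ≤ γ) : (volume : Measure (Rd d)) ≪ wMeasure ρ := by
  refine withDensity_absolutelyContinuous' hρ.aemeasurable_ofReal ?_
  filter_upwards [hρ.ae_pos hd h0 h01] with x hx
  simpa using hx

theorem IsWeight.isLocallyFiniteMeasure (hρ : IsWeight ρ γ₀ γ c C) (hd : 0 < d)
    (h01 : γ₀ ≤ γ) (h1 : γ < d) : IsLocallyFiniteMeasure (wMeasure ρ) := by
  refine ⟨fun x => ⟨Metric.ball x 1, Metric.ball_mem_nhds x one_pos, ?_⟩⟩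
  rw [withDensity_apply _ Metric.isOpen_ball.measurableSet]
  have hi := (integrableOn_norm_rpow_neg_closedBall hd h1 (‖x‖ + 1)).const_mul C
  have hsub : Metric.ball x 1 ⊆ Metric.closedBall (0 : Rd d) (‖x‖ + 1) := by
    intro y hy
    rw [mem_closedBall_zero_iff]
    rw [mem_ball_iff_norm] at hy
    have := norm_add_le (y - x) x
    rw [sub_add_cancel] at this
    linarith
  refine lt_of_le_of_lt (lintegral_mono_ae ?_) 
    (IntegrableOn.mono_set hi hsub).lintegral_lt_top
  filter_upwards [ae_restrict_of_ae (hρ.ae_bounds hd h01)] with y hy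
  exact ENNReal.ofReal_le_ofReal
    (hy.2.trans (mul_le_mul_of_nonneg_left (min_le_right _ _) hρ.C_pos.le))

/-- Split at `t = M`. With `M` a power of `1 + |x|` this replaces Hölder's inequality in the passage
from `L^p` to weighted `L²`, and includes `p = 2`. -/
theorem sq_le_rpow_mul_add_sq {t M p : ℝ} (ht : 0 ≤ t) (hM : 0 < M) (hp : 2 ≤ p) :
    t ^ 2 ≤ t ^ p * M ^ (2 - p) + M ^ 2 := by
  rcases le_or_gt t M with h | h
  · have : t ^ 2 ≤ M ^ 2 := pow_le_pow_left₀ ht h 2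
    have : 0 ≤ t ^ p * M ^ (2 - p) := by positivity
    linarith
  · have ht' : 0 < t := hM.trans h
    have e : t ^ 2 = t ^ p * t ^ (2 - p) := by
      rw [← Real.rpow_add ht', ← Real.rpow_natCast]; congr 1; push_cast; ring
    have h1 : t ^ (2 - p) ≤ M ^ (2 - p) :=
      Real.rpow_le_rpow_of_nonpos hM h.le (by linarith)
    have h2 : t ^ p * t ^ (2 - p) ≤ t ^ p * M ^ (2 - p) :=
      mul_le_mul_of_nonneg_left h1 (by positivity)
    nlinarith [sq_nonneg M]

theorem IsWeight.aestronglyMeasurable (hρ : IsWeight ρ γ₀ γ c C) (hd : 0 < d)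
    (h0 : 0 ≤ γ₀) (h01 : γ₀ ≤ γ) {v : Rd d → ℝ} (hv : AEStronglyMeasurable v (wMeasure ρ)) :
    AEStronglyMeasurable v :=
  hv.mono_ac (hρ.volume_absolutelyContinuous hd h0 h01)

theorem aestronglyMeasurable_wMeasure {v : Rd d → ℝ} (hv : AEStronglyMeasurable v) :
    AEStronglyMeasurable v (wMeasure ρ) :=
  hv.mono_ac (withDensity_absolutelyContinuous _ _)

/-- Below the critical exponent the weighted `L^p` space embeds in `L²((1 + |x|)^(-2s) dx)`. -/
theorem IsWeight.integrable_sq_mul (hρ : IsWeight ρ γ₀ γ c C) (h0 : 0 ≤ γ₀)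
    (h01 : γ₀ ≤ γ) {s p : ℝ} (hs0 : 0 < s) (hds : 2 * s < (d : ℝ)) (hp0 : 2 ≤ p)
    (hp1 : p < 2 * ((d : ℝ) - γ) / ((d : ℝ) - 2 * s)) {v : Rd d → ℝ}
    (hv : MemLpWeight p ρ v) :
    Integrable (fun x => v x ^ 2 * (1 + ‖x‖) ^ (-(2 * s))) := by
  have hd := pos_of_two_mul_lt hs0 hds
  have hvm := hρ.aestronglyMeasurable hd h0 h01 hv.aestronglyMeasurable
  have hi : Integrable (fun x => ρ x * |v x| ^ p) := by
    have h1 := hv.integrable_norm_rpow (by simp; linarith) ENNReal.ofReal_ne_top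
    rw [integrable_withDensity_iff_integrable_smul₀' hρ.aemeasurable_ofReal
      (Eventually.of_forall fun x => ENNReal.ofReal_lt_top)] at h1
    refine h1.congr ?_
    filter_upwards [hρ.ae_pos hd h0 h01] with x hx
    rw [ENNReal.toReal_ofReal hx.le, ENNReal.toReal_ofReal (by linarith), smul_eq_mul,
      Real.norm_eq_abs]
  set a₀ : ℝ := ((d : ℝ) - 2 * s) / 2 with ha₀
  -- This is subcriticality rewritten: at the critical exponent the quantity is zero.
  have he : 0 < 2 * s - γ - a₀ * (p - 2) := by
    rw [lt_div_iff₀ (by linarith)] at hp1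
    rw [ha₀]; nlinarith
  set e := 2 * s - γ - a₀ * (p - 2) with hedef
  -- The threshold is `M = (1+|x|)^(-a)`. The exponent must exceed `a₀`, so that `(1+|x|)^(-2a-2s)`
  -- is integrable, and keep `a(p-2) + γ ≤ 2s`, so that the other term is controlled by `ρ`.
  -- Dividing by `p - 1` rather than `p - 2` stays meaningful at `p = 2`.
  set a := a₀ + e / (p - 1) with ha
  have hp1' : 0 < p - 1 := by linarith
  have ha1 : a₀ < a := by rw [ha]; linarith [div_pos he hp1']
  have ha2 : a * (p - 2) + γ ≤ 2 * s := by
    have : e / (p - 1) * (p - 2) ≤ e := by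
      rw [div_mul_eq_mul_div, div_le_iff₀ hp1']; nlinarith
    rw [ha, add_mul]; linarith
  have hJ : Integrable (fun x : Rd d => (1 + ‖x‖) ^ (-(2 * a + 2 * s))) := by
    apply integrable_one_add_norm
    rw [finrank_Rd]; linarith
  have hc := hρ.c_pos
  refine ((hi.const_mul c⁻¹).add hJ).mono' ?_ ?_
  · exact (hvm.pow 2).mul
      (Measurable.aestronglyMeasurable (by fun_prop))
  · filter_upwards [hρ.ae_lower hd h0 h01] with x hx
    have hb : (1 : ℝ) ≤ 1 + ‖x‖ := by linarith [norm_nonneg x]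
    have hb0 : (0 : ℝ) < 1 + ‖x‖ := by linarith
    simp only [Pi.add_apply]
    rw [Real.norm_eq_abs, abs_of_nonneg (by positivity)]
    have h1 := sq_le_rpow_mul_add_sq (abs_nonneg (v x))
      (Real.rpow_pos_of_pos hb0 (-a)) hp0
    rw [sq_abs] at h1
    have h2 : ((1 + ‖x‖) ^ (-a)) ^ (2 - p) * (1 + ‖x‖) ^ (-(2 * s)) ≤ (1 + ‖x‖) ^ (-γ) := by
      rw [← Real.rpow_mul hb0.le, ← Real.rpow_add hb0]
      exact Real.rpow_le_rpow_of_exponent_le hb (by nlinarith)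
    have h3 : ((1 + ‖x‖) ^ (-a)) ^ 2 * (1 + ‖x‖) ^ (-(2 * s)) =
        (1 + ‖x‖) ^ (-(2 * a + 2 * s)) := by
      rw [← Real.rpow_natCast, ← Real.rpow_mul hb0.le, ← Real.rpow_add hb0]
      congr 1; push_cast; ring
    have h4 : (1 + ‖x‖) ^ (-γ) ≤ c⁻¹ * ρ x := by
      rw [inv_mul_eq_div, le_div_iff₀ hc, mul_comm]; exact hx
    have hvp : 0 ≤ |v x| ^ p := by positivity
    calc v x ^ 2 * (1 + ‖x‖) ^ (-(2 * s)) ≤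
        (|v x| ^ p * ((1 + ‖x‖) ^ (-a)) ^ (2 - p) + ((1 + ‖x‖) ^ (-a)) ^ 2) *
          (1 + ‖x‖) ^ (-(2 * s)) := mul_le_mul_of_nonneg_right h1 (by positivity)
      _ = |v x| ^ p * (((1 + ‖x‖) ^ (-a)) ^ (2 - p) * (1 + ‖x‖) ^ (-(2 * s))) +
          (1 + ‖x‖) ^ (-(2 * a + 2 * s)) := by rw [← h3]; ring
      _ ≤ |v x| ^ p * (c⁻¹ * ρ x) + (1 + ‖x‖) ^ (-(2 * a + 2 * s)) := by
        exact add_le_add_left (mul_le_mul_of_nonneg_left (h2.trans h4) hvp) _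
      _ = _ := by ring

theorem integrable_abs_mul_of_sq {s : ℝ} (hs0 : 0 < s) {v : Rd d → ℝ}
    (hvm : AEStronglyMeasurable v)
    (hv : Integrable (fun x => v x ^ 2 * (1 + ‖x‖) ^ (-(2 * s)))) :
    Integrable (fun x => |v x| * (1 + ‖x‖) ^ (-((d : ℝ) + 2 * s))) := by
  refine (hv.add (integrable_one_add_norm_rpow hs0)).mono'
    (hvm.norm.mul (Measurable.aestronglyMeasurable (by fun_prop)))
    (Eventually.of_forall fun x => ?_)
  have hb : (1 : ℝ) ≤ 1 + ‖x‖ := by linarith [norm_nonneg x]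
  simp only [Pi.add_apply]
  rw [Real.norm_eq_abs, abs_of_nonneg (by positivity)]
  have h1 : |v x| ≤ v x ^ 2 + 1 := by nlinarith [sq_nonneg (|v x| - 1), sq_abs (v x)]
  have h2 : (1 + ‖x‖) ^ (-((d : ℝ) + 2 * s)) ≤ (1 + ‖x‖) ^ (-(2 * s)) :=
    Real.rpow_le_rpow_of_exponent_le hb (by linarith [Nat.cast_nonneg (α := ℝ) d])
  calc |v x| * (1 + ‖x‖) ^ (-((d : ℝ) + 2 * s)) ≤
      (v x ^ 2 + 1) * (1 + ‖x‖) ^ (-((d : ℝ) + 2 * s)) :=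
        mul_le_mul_of_nonneg_right h1 (by positivity)
    _ = v x ^ 2 * (1 + ‖x‖) ^ (-((d : ℝ) + 2 * s)) + (1 + ‖x‖) ^ (-((d : ℝ) + 2 * s)) := by ring
    _ ≤ _ := by gcongr

/-- On bounded sets the weighted `L^p` norm controls the unweighted `L¹` norm. -/
theorem IsWeight.exists_lintegral_le (hρ : IsWeight ρ γ₀ γ c C) (hd : 0 < d) (h0 : 0 ≤ γ₀)
    (h01 : γ₀ ≤ γ) (h1 : γ < d) {p : ℝ} (hp : 1 ≤ p) {K : Set (Rd d)} (hK : IsCompact K) :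
    ∃ A : ENNReal, A ≠ ⊤ ∧ ∀ v : Rd d → ℝ, AEStronglyMeasurable v →
      ∫⁻ x in K, ‖v x‖ₑ ≤ A * eLpNorm v (ENNReal.ofReal p) (wMeasure ρ) := by
  have := hρ.isLocallyFiniteMeasure hd h01 h1
  obtain ⟨R, hR⟩ := hK.isBounded.subset_closedBall 0
  set m : ℝ := c * (1 + |R|) ^ (-γ) with hm
  have hc := hρ.c_pos
  have hm0 : 0 < m := by positivity
  refine ⟨(ENNReal.ofReal m)⁻¹ * (wMeasure ρ K) ^ (1 / (1 : ENNReal).toReal -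
    1 / (ENNReal.ofReal p).toReal), ?_, ?_⟩
  · refine ENNReal.mul_ne_top (by simpa using hm0) (ENNReal.rpow_ne_top_of_nonneg ?_ ?_)
    · rw [ENNReal.toReal_ofReal (by linarith)]
      simp
      exact inv_le_one_of_one_le₀ hp
    · exact hK.measure_lt_top.ne
  · intro v hv
    have hvw : AEStronglyMeasurable v (wMeasure ρ) := aestronglyMeasurable_wMeasure hv
    have hstep : ENNReal.ofReal m * ∫⁻ x in K, ‖v x‖ₑ ≤ ∫⁻ x in K, ‖v x‖ₑ ∂(wMeasure ρ) := by
      rw [restrict_withDensity hK.measurableSet,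
        lintegral_withDensity_eq_lintegral_mul₀ hρ.aemeasurable_ofReal.restrict
          hv.enorm.restrict, ← lintegral_const_mul'' _ hv.enorm.restrict]
      refine lintegral_mono_ae ?_
      filter_upwards [ae_restrict_of_ae (hρ.ae_lower hd h0 h01), ae_restrict_mem hK.measurableSet]
        with x hx hxK
      simp only [Pi.mul_apply]
      gcongr
      refine le_trans (mul_le_mul_of_nonneg_left ?_ hc.le) hx
      have h2 := hR hxK
      rw [mem_closedBall_zero_iff] at h2
      exact Real.rpow_le_rpow_of_nonpos (by positivity) (by linarith [le_abs_self R])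
        (by linarith)
    have hH := eLpNorm_le_eLpNorm_mul_rpow_measure_univ (μ := (wMeasure ρ).restrict K)
      (p := 1) (q := ENNReal.ofReal p) (by simpa using hp) hvw.restrict
    rw [eLpNorm_one_eq_lintegral_enorm, Measure.restrict_apply_univ] at hH
    have hmono : eLpNorm v (ENNReal.ofReal p) ((wMeasure ρ).restrict K) ≤
        eLpNorm v (ENNReal.ofReal p) (wMeasure ρ) := eLpNorm_mono_measure _ Measure.restrict_le_self
    have hm' : ENNReal.ofReal m ≠ 0 := by simpa using hm0
    calc ∫⁻ x in K, ‖v x‖ₑ = (ENNReal.ofReal m)⁻¹ * (ENNReal.ofReal m * ∫⁻ x in K, ‖v x‖ₑ) := by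
          rw [← mul_assoc, ENNReal.inv_mul_cancel hm' ENNReal.ofReal_ne_top, one_mul]
      _ ≤ (ENNReal.ofReal m)⁻¹ * (eLpNorm v (ENNReal.ofReal p) (wMeasure ρ) *
          (wMeasure ρ K) ^ (1 / (1 : ENNReal).toReal - 1 / (ENNReal.ofReal p).toReal)) := by
        exact mul_le_mul_right (hstep.trans (hH.trans (mul_le_mul_left hmono _))) _
      _ = _ := by ring

theorem IsWeight.locallyIntegrable (hρ : IsWeight ρ γ₀ γ c C) (hd : 0 < d) (h0 : 0 ≤ γ₀)
    (h01 : γ₀ ≤ γ) (h1 : γ < d) {p : ℝ} (hp : 1 ≤ p) {v : Rd d → ℝ} (hv : MemLpWeight p ρ v) :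
    LocallyIntegrable v := by
  rw [locallyIntegrable_iff]
  intro K hK
  obtain ⟨A, hA, H⟩ := hρ.exists_lintegral_le hd h0 h01 h1 hp hK
  have hvm := hρ.aestronglyMeasurable hd h0 h01 hv.aestronglyMeasurable
  exact ⟨hvm.restrict, lt_of_le_of_lt (H v hvm) (ENNReal.mul_lt_top hA.lt_top hv.2)⟩

/-- Hölder's inequality for the duality between `L^p_ρ` and `{f | ρ⁻¹ f ∈ L^{p'}_ρ}`. -/
theorem IsWeight.lintegral_mul_le (hρ : IsWeight ρ γ₀ γ c C) (hd : 0 < d) (h0 : 0 ≤ γ₀)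
    (h01 : γ₀ ≤ γ) {p : ℝ} (hp : 1 < p) {f u : Rd d → ℝ}
    (hf : MemLpWeight (p / (p - 1)) ρ (fun x => (ρ x)⁻¹ * f x))
    (hu : AEStronglyMeasurable u) :
    ∫⁻ x, ‖f x * u x‖ₑ ≤
      eLpNorm (fun x => (ρ x)⁻¹ * f x) (ENNReal.ofReal (p / (p - 1))) (wMeasure ρ) *
        eLpNorm u (ENNReal.ofReal p) (wMeasure ρ) := by
  have hpq : Real.HolderConjugate (p / (p - 1)) p := (Real.HolderConjugate.conjExponent hp).symm
  have hpq' : ENNReal.HolderConjugate (ENNReal.ofReal (p / (p - 1))) (ENNReal.ofReal p) :=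
    hpq.ennrealOfReal
  have hH := eLpNorm_smul_le_mul_eLpNorm (μ := wMeasure ρ) (p := ENNReal.ofReal (p / (p - 1)))
    (q := ENNReal.ofReal p) (r := 1) (aestronglyMeasurable_wMeasure hu) hf.aestronglyMeasurable
  refine le_trans (le_of_eq ?_) hH
  have hgm := hρ.aestronglyMeasurable hd h0 h01 hf.aestronglyMeasurable
  rw [eLpNorm_one_eq_lintegral_enorm, lintegral_withDensity_eq_lintegral_mul₀
    hρ.aemeasurable_ofReal (hgm.smul hu).enorm]
  refine lintegral_congr_ae ?_
  filter_upwards [hρ.ae_pos hd h0 h01] with x hx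
  simp only [Pi.mul_apply, Pi.smul_apply', smul_eq_mul]
  -- The density `ρ` of the measure cancels the factor `ρ⁻¹`, so the weighted pairing is the
  -- unweighted one.
  rw [← Real.enorm_of_nonneg hx.le, ← enorm_mul]
  congr 1
  field_simp

theorem IsWeight.aestronglyMeasurable_of_inv_mul (hρ : IsWeight ρ γ₀ γ c C) (hd : 0 < d)
    (h0 : 0 ≤ γ₀) (h01 : γ₀ ≤ γ) {q : ℝ} {f : Rd d → ℝ}
    (hf : MemLpWeight q ρ (fun x => (ρ x)⁻¹ * f x)) : AEStronglyMeasurable f := by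
  have h1 := hρ.aestronglyMeasurable hd h0 h01 hf.aestronglyMeasurable
  refine (hρ.aemeasurable.aestronglyMeasurable.mul h1).congr ?_
  filter_upwards [hρ.ae_pos hd h0 h01] with x hx
  simp only [Pi.mul_apply]
  field_simp

theorem IsWeight.integrable_mul (hρ : IsWeight ρ γ₀ γ c C) (hd : 0 < d) (h0 : 0 ≤ γ₀)
    (h01 : γ₀ ≤ γ) {p : ℝ} (hp : 1 < p) {f u : Rd d → ℝ}
    (hf : MemLpWeight (p / (p - 1)) ρ (fun x => (ρ x)⁻¹ * f x)) (hu : MemLpWeight p ρ u) :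
    Integrable (fun x => f x * u x) := by
  have hum := hρ.aestronglyMeasurable hd h0 h01 hu.aestronglyMeasurable
  exact ⟨(hρ.aestronglyMeasurable_of_inv_mul hd h0 h01 hf).mul hum,
    lt_of_le_of_lt (hρ.lintegral_mul_le hd h0 h01 hp hf hum) (ENNReal.mul_lt_top hf.2 hu.2)⟩

theorem IsWeight.tendsto_integral_mul (hρ : IsWeight ρ γ₀ γ c C) (hd : 0 < d) (h0 : 0 ≤ γ₀)
    (h01 : γ₀ ≤ γ) {p : ℝ} (hp : 1 < p) {f u : Rd d → ℝ}
    (hf : MemLpWeight (p / (p - 1)) ρ (fun x => (ρ x)⁻¹ * f x)) (hu : MemLpWeight p ρ u)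
    {U : ℕ → Rd d → ℝ} (hU : ∀ n, MemLpWeight p ρ (U n))
    (hlim : Tendsto (fun n => eLpNorm (U n - u) (ENNReal.ofReal p) (wMeasure ρ)) atTop (𝓝 0)) :
    Tendsto (fun n => ∫ x, f x * U n x) atTop (𝓝 (∫ x, f x * u x)) := by
  refine tendsto_integral_of_L1 _ (hρ.integrable_mul hd h0 h01 hp hf hu).aestronglyMeasurable
    (Eventually.of_forall fun n => hρ.integrable_mul hd h0 h01 hp hf (hU n)) ?_
  have hT := ENNReal.Tendsto.const_mul (a := eLpNorm (fun x => (ρ x)⁻¹ * f x)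
    (ENNReal.ofReal (p / (p - 1))) (wMeasure ρ)) hlim (Or.inr hf.2.ne)
  rw [mul_zero] at hT
  refine tendsto_of_tendsto_of_tendsto_of_le_of_le tendsto_const_nhds hT
    (fun n => zero_le) (fun n => ?_)
  have hum := hρ.aestronglyMeasurable hd h0 h01 hu.aestronglyMeasurable
  have hUm := hρ.aestronglyMeasurable hd h0 h01 (hU n).aestronglyMeasurable
  refine le_trans (le_of_eq ?_) (hρ.lintegral_mul_le hd h0 h01 hp hf (hUm.sub hum))
  congr 1; ext x
  simp only [Pi.sub_apply, mul_sub]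

end Weight

/-! ### Mollification in the weighted spaces -/

/-- Convolution with a normalized bump function. -/
def moll (b : ContDiffBump (0 : Rd d)) (u : Rd d → ℝ) : Rd d → ℝ :=
  convolution (b.normed volume) u (ContinuousLinearMap.lsmul ℝ ℝ) volume

theorem moll_apply (b : ContDiffBump (0 : Rd d)) (u : Rd d → ℝ) (x : Rd d) :
    moll b u x = ∫ t, b.normed volume t * u (x - t) := rfl

theorem continuous_normed (b : ContDiffBump (0 : Rd d)) : Continuous (b.normed volume) :=
  b.continuous_normed

theorem lintegral_normed (b : ContDiffBump (0 : Rd d)) :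
    ∫⁻ t, ENNReal.ofReal (b.normed volume t) = 1 := by
  rw [← ofReal_integral_eq_lintegral_ofReal b.integrable_normed
    (Eventually.of_forall fun t => b.nonneg_normed t), b.integral_normed, ENNReal.ofReal_one]

/-- The `A₁` property of `|x|^(-a)`. If `y` is far from the origin compared with the bump radius
`δ`, the power is comparable to `|y|^(-a)` on the support. Otherwise the bump is at most a constant
times `δ^(-d)` and lives in a ball of radius `6δ`, where scaling gives a multiple of `δ^(-a)`.
Fixing the ratio of the radii makes the constant independent of the bump. -/
theorem exists_lintegral_normed_mul_norm_rpow_le (hd : 0 < d) {a : ℝ} (ha0 : 0 ≤ a)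
    (ha : a < d) :
    ∃ A, 0 < A ∧ ∀ b : ContDiffBump (0 : Rd d), b.rOut = 2 * b.rIn → ∀ y : Rd d, y ≠ 0 →
      ∫⁻ x, ENNReal.ofReal (b.normed volume (x - y)) * ENNReal.ofReal (‖x‖ ^ (-a)) ≤
        ENNReal.ofReal (A * ‖y‖ ^ (-a)) := by
  set K := ∫ x in Metric.closedBall (0 : Rd d) 1, ‖x‖ ^ (-a) with hK
  have hK0 : 0 ≤ K := integral_nonneg fun x => by positivity
  set V := volume.real (Metric.ball (0 : Rd d) 1) with hV
  have hV0 : 0 < V :=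
    ENNReal.toReal_pos (Metric.measure_ball_pos _ _ one_pos).ne'
      Metric.isBounded_ball.measure_lt_top.ne
  clear_value V K
  refine ⟨2 ^ a + 6 ^ d * K / V, by positivity, ?_⟩
  intro b hb y hy
  set δ := b.rIn with hδ
  have hδ0 : 0 < δ := b.rIn_pos
  have hy0 := norm_pos_iff.2 hy
  have hsupp : ∀ x, 2 * δ ≤ ‖x - y‖ → b.normed volume (x - y) = 0 := by
    intro x hx
    by_contra h
    have : x - y ∈ Function.support (b.normed volume) := h
    rw [b.support_normed_eq, mem_ball_zero_iff, hb] at this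
    linarith
  rcases le_or_gt (4 * δ) ‖y‖ with h | h
  · have hpt : ∀ x, ENNReal.ofReal (b.normed volume (x - y)) * ENNReal.ofReal (‖x‖ ^ (-a)) ≤
        ENNReal.ofReal (b.normed volume (x - y)) * ENNReal.ofReal (2 ^ a * ‖y‖ ^ (-a)) := by
      intro x
      rcases le_or_gt (2 * δ) ‖x - y‖ with hx | hx
      · rw [hsupp x hx]; simp
      · gcongr
        have h1 : ‖y‖ / 2 ≤ ‖x‖ := by
          have := norm_sub_le x (x - y)
          rw [sub_sub_cancel] at this
          linarith
        have h2 : (2 : ℝ) ^ a * ‖y‖ ^ (-a) = (‖y‖ / 2) ^ (-a) := by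
          rw [Real.div_rpow hy0.le (by norm_num), Real.rpow_neg (by norm_num : (0 : ℝ) ≤ 2)]
          field_simp
        rw [h2]
        exact Real.rpow_le_rpow_of_nonpos (by positivity) h1 (by linarith)
    refine (lintegral_mono hpt).trans ?_
    rw [lintegral_mul_const _ (by
      have := continuous_normed b
      exact (Continuous.measurable (by fun_prop)).ennreal_ofReal)]
    rw [lintegral_sub_right_eq_self (fun x => ENNReal.ofReal (b.normed volume x)) y,
      lintegral_normed, one_mul]
    apply ENNReal.ofReal_le_ofReal
    apply mul_le_mul_of_nonneg_right _ (by positivity)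
    have : 0 ≤ 6 ^ d * K / V := by positivity
    linarith
  · have hpt : ∀ x, ENNReal.ofReal (b.normed volume (x - y)) * ENNReal.ofReal (‖x‖ ^ (-a)) ≤
        (Metric.closedBall (0 : Rd d) (6 * δ)).indicator
          (fun x => ENNReal.ofReal (1 / (δ ^ d * V) * ‖x‖ ^ (-a))) x := by
      intro x
      rcases le_or_gt (2 * δ) ‖x - y‖ with hx | hx
      · rw [hsupp x hx]; simp
      · have h1 : x ∈ Metric.closedBall (0 : Rd d) (6 * δ) := by
          rw [mem_closedBall_zero_iff]
          have := norm_add_le (x - y) y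
          rw [sub_add_cancel] at this
          linarith
        rw [Set.indicator_of_mem h1, ENNReal.ofReal_mul (by positivity)]
        gcongr
        have h2 := b.normed_le_div_measure_closedBall_rIn volume (x - y)
        rwa [Measure.addHaar_real_closedBall _ _ hδ0.le, finrank_Rd, ← hV] at h2
    refine (lintegral_mono hpt).trans ?_
    have hint := (integrableOn_norm_rpow_neg_closedBall hd ha (6 * δ)).const_mul
      (1 / (δ ^ d * V))
    rw [lintegral_indicator Metric.isClosed_closedBall.measurableSet,
      ← ofReal_integral_eq_lintegral_ofReal hint
        (Eventually.of_forall fun x => by positivity)]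
    apply ENNReal.ofReal_le_ofReal
    have h6 : 0 < 6 * δ := by positivity
    have hscale : ∫ x in Metric.closedBall (0 : Rd d) (6 * δ), ‖x‖ ^ (-a) =
        (6 * δ) ^ d * (6 * δ) ^ (-a) * K := by
      have := Measure.setIntegral_comp_smul_of_pos (volume : Measure (Rd d))
        (fun x : Rd d => ‖x‖ ^ (-a)) (Metric.closedBall 0 1) h6
      rw [smul_unitClosedBall_of_nonneg h6.le, finrank_Rd] at this
      simp only [norm_smul, Real.norm_of_nonneg h6.le, smul_eq_mul,
        Real.mul_rpow h6.le (norm_nonneg _)] at this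
      rw [integral_const_mul, ← hK] at this
      rw [mul_assoc, this]
      field_simp
    rw [integral_const_mul, hscale]
    have h7 : (6 * δ) ^ (-a) ≤ ‖y‖ ^ (-a) :=
      Real.rpow_le_rpow_of_nonpos hy0 (by linarith) (by linarith)
    have h8 : 1 / (δ ^ d * V) * ((6 * δ) ^ d * (6 * δ) ^ (-a) * K) =
        6 ^ d * K / V * (6 * δ) ^ (-a) := by
      rw [mul_pow]; field_simp
    rw [h8]
    have h9 : 0 ≤ 6 ^ d * K / V := by positivity
    have h10 := mul_le_mul_of_nonneg_left h7 h9
    have h11 : 0 ≤ (2 : ℝ) ^ a * ‖y‖ ^ (-a) := by positivity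
    rw [add_mul]; linarith

section Weight

variable {ρ : Rd d → ℝ} {γ₀ γ c C : ℝ}

/-- The weight satisfies Muckenhoupt's `A₁` condition with respect to bump averages. -/
theorem IsWeight.exists_lintegral_normed_mul_le (hρ : IsWeight ρ γ₀ γ c C) (hd : 0 < d)
    (h0 : 0 ≤ γ₀) (h01 : γ₀ ≤ γ) (h1 : γ < d) :
    ∃ A : ENNReal, A ≠ ⊤ ∧ ∀ b : ContDiffBump (0 : Rd d), b.rOut = 2 * b.rIn → ∀ᵐ y : Rd d,
      ∫⁻ x, ENNReal.ofReal (b.normed volume (x - y)) * ENNReal.ofReal (ρ x) ≤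
        A * ENNReal.ofReal (ρ y) := by
  obtain ⟨A₀, hA₀, H₀⟩ := exists_lintegral_normed_mul_norm_rpow_le hd h0 (h01.trans_lt h1)
  obtain ⟨A₁, hA₁, H₁⟩ := exists_lintegral_normed_mul_norm_rpow_le hd (h0.trans h01) h1
  have hc := hρ.c_pos
  have hC := hρ.C_pos
  refine ⟨ENNReal.ofReal (C * (max A₀ A₁) / c), ENNReal.ofReal_ne_top, ?_⟩
  intro b hb
  filter_upwards [hρ.ae_bounds hd h01, ae_ne_zero_Rd hd] with y hy hy0
  -- The minimum of the two powers lies below each, so the average is bounded by each power at `y`,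
  -- hence by their minimum, which is comparable to `ρ y`.
  have key : ∀ a A : ℝ, 0 < A → A ≤ max A₀ A₁ →
      (∀ x : Rd d, min (‖x‖ ^ (-γ₀)) (‖x‖ ^ (-γ)) ≤ ‖x‖ ^ (-a)) →
      ∫⁻ x, ENNReal.ofReal (b.normed volume (x - y)) * ENNReal.ofReal (‖x‖ ^ (-a)) ≤
        ENNReal.ofReal (A * ‖y‖ ^ (-a)) →
      ∫⁻ x, ENNReal.ofReal (b.normed volume (x - y)) * ENNReal.ofReal (ρ x) ≤
        ENNReal.ofReal (C * max A₀ A₁ * ‖y‖ ^ (-a)) := by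
    intro a A hA hAm hmin hle
    have hm : Measurable fun x => ENNReal.ofReal (b.normed volume (x - y)) *
        ENNReal.ofReal (‖x‖ ^ (-a)) := by
      have := continuous_normed b
      have h2 : Measurable fun x : Rd d => ENNReal.ofReal (b.normed volume (x - y)) :=
        (Continuous.measurable (by fun_prop)).ennreal_ofReal
      exact h2.mul (by fun_prop)
    calc _ ≤ ∫⁻ x, ENNReal.ofReal C * (ENNReal.ofReal (b.normed volume (x - y)) *
          ENNReal.ofReal (‖x‖ ^ (-a))) := by
          refine lintegral_mono_ae ?_
          filter_upwards [hρ.ae_bounds hd h01] with x hx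
          rw [mul_left_comm, ← ENNReal.ofReal_mul hC.le]
          gcongr
          exact hx.2.trans (mul_le_mul_of_nonneg_left (hmin x) hC.le)
      _ ≤ ENNReal.ofReal C * ENNReal.ofReal (A * ‖y‖ ^ (-a)) := by
          rw [lintegral_const_mul _ hm]; gcongr
      _ ≤ _ := by
          rw [← ENNReal.ofReal_mul hC.le, mul_assoc]
          gcongr
  have k0 := key γ₀ A₀ hA₀ (le_max_left _ _) (fun x => min_le_left _ _) (H₀ b hb y hy0)
  have k1 := key γ A₁ hA₁ (le_max_right _ _) (fun x => min_le_right _ _) (H₁ b hb y hy0)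
  rw [← ENNReal.ofReal_mul (by positivity)]
  have hfin : ∀ t : ℝ, t ≤ ‖y‖ ^ (-γ₀) → t = min (‖y‖ ^ (-γ₀)) (‖y‖ ^ (-γ)) →
      C * max A₀ A₁ * t ≤ C * max A₀ A₁ / c * ρ y := by
    intro t _ ht
    rw [div_mul_eq_mul_div, mul_div_assoc]
    refine mul_le_mul_of_nonneg_left ?_ (by positivity)
    rw [le_div_iff₀ hc, ht, mul_comm]
    exact hy.1
  rcases le_total (‖y‖ ^ (-γ₀)) (‖y‖ ^ (-γ)) with h | h
  · exact k0.trans (ENNReal.ofReal_le_ofReal (hfin _ le_rfl (min_eq_left h).symm))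
  · exact k1.trans (ENNReal.ofReal_le_ofReal (hfin _ h (min_eq_right h).symm))

/-- Jensen's inequality for the probability measure with the bump as density, in the form that `L^p`
norms on a probability space increase with `p`. -/
theorem enorm_moll_rpow_le (b : ContDiffBump (0 : Rd d)) {u : Rd d → ℝ}
    (hu : AEStronglyMeasurable u) {p : ℝ} (hp : 1 ≤ p) (x : Rd d) :
    ‖moll b u x‖ₑ ^ p ≤
      ∫⁻ y, ENNReal.ofReal (b.normed volume (x - y)) * ‖u y‖ₑ ^ p := by
  have hbm : Measurable fun t => ENNReal.ofReal (b.normed volume t) :=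
    (continuous_normed b).measurable.ennreal_ofReal
  have hux : AEStronglyMeasurable (fun t => u (x - t)) :=
    hu.comp_quasiMeasurePreserving (quasiMeasurePreserving_sub_left volume x)
  set P : Measure (Rd d) := volume.withDensity fun t => ENNReal.ofReal (b.normed volume t) with hP
  have : IsProbabilityMeasure P := by
    refine ⟨?_⟩
    rw [hP, withDensity_apply _ MeasurableSet.univ, Measure.restrict_univ, lintegral_normed]
  have h1 : ‖moll b u x‖ₑ ≤ ∫⁻ t, ‖u (x - t)‖ₑ ∂P := by
    rw [moll_apply, hP, lintegral_withDensity_eq_lintegral_mul₀ hbm.aemeasurable hux.enorm]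
    refine (enorm_integral_le_lintegral_enorm _).trans (le_of_eq ?_)
    congr 1; ext t
    rw [enorm_mul, Real.enorm_of_nonneg (b.nonneg_normed t)]
    rfl
  have huP : AEStronglyMeasurable (fun t => u (x - t)) P :=
    hux.mono_ac (withDensity_absolutelyContinuous _ _)
  have h2 := eLpNorm_le_eLpNorm_of_exponent_le (μ := P) (p := 1) (q := ENNReal.ofReal p)
    (by simpa using hp) huP
  have hp0 : 0 < p := by linarith
  rw [eLpNorm_one_eq_lintegral_enorm, eLpNorm_eq_lintegral_rpow_enorm_toReal (by simpa using hp0)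
    ENNReal.ofReal_ne_top, ENNReal.toReal_ofReal hp0.le] at h2
  have h3 := ENNReal.rpow_le_rpow (h1.trans h2) hp0.le
  rw [← ENNReal.rpow_mul, one_div_mul_cancel hp0.ne', ENNReal.rpow_one] at h3
  refine h3.trans (le_of_eq ?_)
  rw [hP, lintegral_withDensity_eq_lintegral_mul₀ hbm.aemeasurable (hux.enorm.pow_const p),
    ← lintegral_sub_left_eq_self _ x]
  congr 1; ext t
  simp

/-- After Jensen, Tonelli transfers the average from `|u|^p` to the weight, where the `A₁` condition
absorbs it. The bound is uniform over bumps. -/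
theorem IsWeight.exists_eLpNorm_moll_le (hρ : IsWeight ρ γ₀ γ c C) (hd : 0 < d)
    (h0 : 0 ≤ γ₀) (h01 : γ₀ ≤ γ) (h1 : γ < d) {p : ℝ} (hp : 1 ≤ p) :
    ∃ A : ENNReal, A ≠ ⊤ ∧ ∀ b : ContDiffBump (0 : Rd d), b.rOut = 2 * b.rIn →
      ∀ u : Rd d → ℝ, AEStronglyMeasurable u → AEStronglyMeasurable (moll b u) →
      eLpNorm (moll b u) (ENNReal.ofReal p) (wMeasure ρ) ≤
        A * eLpNorm u (ENNReal.ofReal p) (wMeasure ρ) := by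
  obtain ⟨A, hA, H⟩ := hρ.exists_lintegral_normed_mul_le hd h0 h01 h1
  have hp0 : 0 < p := by linarith
  refine ⟨A ^ (1 / p), ENNReal.rpow_ne_top_of_nonneg (by positivity) hA, ?_⟩
  intro b hb u hu hmu
  have hmeas : AEMeasurable (fun z : Rd d × Rd d => ENNReal.ofReal (ρ z.1) *
      (ENNReal.ofReal (b.normed volume (z.1 - z.2)) * ‖u z.2‖ₑ ^ p)) (volume.prod volume) := by
    have hb' := continuous_normed b
    have e1 : AEMeasurable (fun z : Rd d × Rd d => ENNReal.ofReal (ρ z.1)) (volume.prod volume) :=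
      hρ.aemeasurable_ofReal.comp_fst
    have e2 : Measurable fun z : Rd d × Rd d => ENNReal.ofReal (b.normed volume (z.1 - z.2)) :=
      (Continuous.measurable (by fun_prop)).ennreal_ofReal
    have e3 : AEMeasurable (fun z : Rd d × Rd d => ‖u z.2‖ₑ ^ p) (volume.prod volume) :=
      (hu.comp_snd.enorm).pow_const p
    exact e1.mul (e2.aemeasurable.mul e3)
  have hmain : ∫⁻ x, ‖moll b u x‖ₑ ^ p ∂(wMeasure ρ) ≤ A * ∫⁻ x, ‖u x‖ₑ ^ p ∂(wMeasure ρ) := by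
    rw [lintegral_withDensity_eq_lintegral_mul₀ hρ.aemeasurable_ofReal (hmu.enorm.pow_const p),
      lintegral_withDensity_eq_lintegral_mul₀ hρ.aemeasurable_ofReal (hu.enorm.pow_const p)]
    have hup : AEMeasurable fun y => ‖u y‖ₑ ^ p := hu.enorm.pow_const p
    calc _ ≤ ∫⁻ x, ∫⁻ y, ENNReal.ofReal (ρ x) *
          (ENNReal.ofReal (b.normed volume (x - y)) * ‖u y‖ₑ ^ p) := by
          refine lintegral_mono fun x => ?_
          simp only [Pi.mul_apply]
          have hb' := continuous_normed b
          have hq : AEMeasurable fun y => ENNReal.ofReal (b.normed volume (x - y)) * ‖u y‖ₑ ^ p :=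
            (Continuous.measurable (by fun_prop)).ennreal_ofReal.aemeasurable.mul hup
          rw [lintegral_const_mul'' _ hq]
          gcongr
          exact enorm_moll_rpow_le b hu hp x
      _ = ∫⁻ y, ∫⁻ x, ENNReal.ofReal (ρ x) *
          (ENNReal.ofReal (b.normed volume (x - y)) * ‖u y‖ₑ ^ p) :=
          lintegral_lintegral_swap hmeas
      _ = ∫⁻ y, (∫⁻ x, ENNReal.ofReal (b.normed volume (x - y)) * ENNReal.ofReal (ρ x)) *
          ‖u y‖ₑ ^ p := by
          congr 1; ext y
          rw [← lintegral_mul_const'']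
          · congr 1; ext x; ring
          · have hb' := continuous_normed b
            exact (Continuous.measurable (by fun_prop)).ennreal_ofReal.aemeasurable.mul
              hρ.aemeasurable_ofReal
      _ ≤ ∫⁻ y, A * (ENNReal.ofReal (ρ y) * ‖u y‖ₑ ^ p) := by
          refine lintegral_mono_ae ?_
          filter_upwards [H b hb] with y hy
          rw [← mul_assoc]
          gcongr
      _ = _ := by
          have hq : AEMeasurable fun y => ENNReal.ofReal (ρ y) * ‖u y‖ₑ ^ p :=
            hρ.aemeasurable_ofReal.mul hup
          rw [lintegral_const_mul'' _ hq]
          rfl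
  rw [eLpNorm_eq_lintegral_rpow_enorm_toReal (by simpa using hp0) ENNReal.ofReal_ne_top,
    eLpNorm_eq_lintegral_rpow_enorm_toReal (by simpa using hp0) ENNReal.ofReal_ne_top,
    ENNReal.toReal_ofReal hp0.le, ← ENNReal.mul_rpow_of_nonneg _ _ (by positivity)]
  exact ENNReal.rpow_le_rpow hmain (by positivity)

end Weight

theorem contDiff_moll (b : ContDiffBump (0 : Rd d)) {u : Rd d → ℝ} (hu : LocallyIntegrable u) :
    ContDiff ℝ ∞ (moll b u) :=
  b.hasCompactSupport_normed.contDiff_convolution_left _ b.contDiff_normed hu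

theorem moll_sub (b : ContDiffBump (0 : Rd d)) {u w : Rd d → ℝ} (hu : LocallyIntegrable u)
    (hw : LocallyIntegrable w) : moll b (u - w) = moll b u - moll b w := by
  have h : ∀ {f : Rd d → ℝ}, LocallyIntegrable f → ∀ x,
      Integrable fun t => b.normed volume t * f (x - t) := fun {f} hf x =>
    b.hasCompactSupport_normed.convolutionExists_left (ContinuousLinearMap.lsmul ℝ ℝ)
      (continuous_normed b) hf x
  ext x
  simp only [Pi.sub_apply, moll_apply, mul_sub]
  exact integral_sub (h hu x) (h hw x)

section Weight

variable {ρ : Rd d → ℝ} {γ₀ γ c C : ℝ}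

theorem IsWeight.memLp_moll (hρ : IsWeight ρ γ₀ γ c C) (hd : 0 < d)
    (h0 : 0 ≤ γ₀) (h01 : γ₀ ≤ γ) (h1 : γ < d) {p : ℝ} (hp : 1 ≤ p) {u : Rd d → ℝ}
    (hu : MemLpWeight p ρ u) {b : ContDiffBump (0 : Rd d)} (hb : b.rOut = 2 * b.rIn) :
    MemLpWeight p ρ (moll b u) := by
  obtain ⟨A, hA, H⟩ := hρ.exists_eLpNorm_moll_le hd h0 h01 h1 hp
  have hum := hρ.aestronglyMeasurable hd h0 h01 hu.aestronglyMeasurable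
  have hm : AEStronglyMeasurable (moll b u) :=
    (contDiff_moll b (hρ.locallyIntegrable hd h0 h01 h1 hp hu)).continuous.aestronglyMeasurable
  exact ⟨aestronglyMeasurable_wMeasure hm,
    (H b hb u hum hm).trans_lt (ENNReal.mul_lt_top hA.lt_top hu.2)⟩

theorem IsWeight.tendsto_eLpNorm_moll_sub_of_continuous (hρ : IsWeight ρ γ₀ γ c C) (hd : 0 < d)
    (h01 : γ₀ ≤ γ) (h1 : γ < d) {p : ℝ} (hp : 1 ≤ p) {g : Rd d → ℝ}
    (hg : Continuous g) (hgc : HasCompactSupport g) {b : ℕ → ContDiffBump (0 : Rd d)}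
    (hb0 : Tendsto (fun n => (b n).rOut) atTop (𝓝 0)) :
    Tendsto (fun n => eLpNorm (moll (b n) g - g) (ENNReal.ofReal p) (wMeasure ρ)) atTop (𝓝 0) := by
  have hp0 : 0 < p := by linarith
  have := hρ.isLocallyFiniteMeasure hd h01 h1
  obtain ⟨R, hR⟩ := hgc.isCompact.isBounded.subset_closedBall 0
  have hg0 : ∀ x, R < ‖x‖ → g x = 0 := by
    intro x hx
    by_contra h
    have := hR (subset_tsupport _ h)
    rw [mem_closedBall_zero_iff] at this
    linarith
  have huc : UniformContinuous g := hgc.uniformContinuous_of_continuous hg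
  -- Once the bump radius is below one, the mollification of `g` vanishes outside this ball, which
  -- has finite weighted measure.
  set B := Metric.closedBall (0 : Rd d) (R + 1) with hB
  have hBfin : wMeasure ρ B ≠ ⊤ := (isCompact_closedBall _ _).measure_lt_top.ne
  set m : ENNReal := (wMeasure ρ B) ^ (1 / p) with hm
  have hmfin : m ≠ ⊤ := ENNReal.rpow_ne_top_of_nonneg (by positivity) hBfin
  have key : ∀ ε : ℝ, 0 < ε → ∀ᶠ n in atTop,
      eLpNorm (moll (b n) g - g) (ENNReal.ofReal p) (wMeasure ρ) ≤ m * ENNReal.ofReal ε := by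
    intro ε hε
    obtain ⟨δ, hδ, hδε⟩ := Metric.uniformContinuous_iff.1 huc ε hε
    filter_upwards [hb0.eventually (gt_mem_nhds hδ), hb0.eventually (gt_mem_nhds one_pos)]
      with n hn hn1
    have hpt : ∀ x, ‖(moll (b n) g - g) x‖ ≤ ‖B.indicator (fun _ => ε) x‖ := by
      intro x
      by_cases hx : x ∈ B
      · rw [Set.indicator_of_mem hx, Real.norm_of_nonneg hε.le, Pi.sub_apply, ← dist_eq_norm]
        refine ContDiffBump.dist_normed_convolution_le hg.aestronglyMeasurable fun y hy => ?_
        exact (hδε ((Metric.mem_ball.1 hy).trans hn)).le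
      · rw [mem_closedBall_zero_iff, not_le] at hx
        have h2 : moll (b n) g x = g x := by
          rw [← dist_le_zero]
          refine ContDiffBump.dist_normed_convolution_le hg.aestronglyMeasurable fun y hy => ?_
          rw [mem_ball_iff_norm] at hy
          have h3 := norm_sub_le y (y - x)
          rw [sub_sub_cancel] at h3
          rw [hg0 y (by linarith), hg0 x (by linarith), dist_self]
        rw [Pi.sub_apply, h2, sub_self, norm_zero]
        positivity
    refine (eLpNorm_mono hpt).trans ?_
    rw [eLpNorm_indicator_const Metric.isClosed_closedBall.measurableSet (by simpa using hp0)
      ENNReal.ofReal_ne_top, ENNReal.toReal_ofReal hp0.le, mul_comm,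
      Real.enorm_of_nonneg hε.le]
  rw [ENNReal.tendsto_nhds_zero]
  intro ε hε
  have hT : Tendsto (fun t : ℝ => m * ENNReal.ofReal t) (𝓝[>] 0) (𝓝 0) := by
    have h2 : Tendsto (fun t : ℝ => ENNReal.ofReal t) (𝓝[>] 0) (𝓝 0) := by
      have := (ENNReal.continuous_ofReal.tendsto 0).mono_left
        (nhdsWithin_le_nhds (s := Set.Ioi 0))
      simpa using this
    have := ENNReal.Tendsto.const_mul h2 (Or.inr hmfin)
    rwa [mul_zero] at this
  obtain ⟨t, ht, ht0⟩ := ((hT.eventually (gt_mem_nhds hε)).and self_mem_nhdsWithin).exists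
  filter_upwards [key t ht0] with n hn
  exact hn.trans ht.le

theorem IsWeight.tendsto_eLpNorm_moll_sub (hρ : IsWeight ρ γ₀ γ c C) (hd : 0 < d)
    (h0 : 0 ≤ γ₀) (h01 : γ₀ ≤ γ) (h1 : γ < d) {p : ℝ} (hp : 1 ≤ p) {u : Rd d → ℝ}
    (hu : MemLpWeight p ρ u) {b : ℕ → ContDiffBump (0 : Rd d)}
    (hb : ∀ n, (b n).rOut = 2 * (b n).rIn) (hb0 : Tendsto (fun n => (b n).rOut) atTop (𝓝 0)) :
    Tendsto (fun n => eLpNorm (moll (b n) u - u) (ENNReal.ofReal p) (wMeasure ρ)) atTop (𝓝 0) := by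
  obtain ⟨A, hA, H⟩ := hρ.exists_eLpNorm_moll_le hd h0 h01 h1 hp
  have := hρ.isLocallyFiniteMeasure hd h01 h1
  have hP1 : (1 : ENNReal) ≤ ENNReal.ofReal p := by simpa using hp
  have hul := hρ.locallyIntegrable hd h0 h01 h1 hp hu
  rw [ENNReal.tendsto_nhds_zero]
  intro ε hε
  rcases eq_or_ne ε ⊤ with rfl | hεt
  · exact Eventually.of_forall fun n => le_top
  have hA1 : A + 1 ≠ ⊤ := by simpa using hA
  have hA0 : A + 1 ≠ 0 := by simp
  have hε2 : ε / 2 ≠ 0 := by simpa using hε.ne'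
  -- Approximating `u` by `g` within `η` costs `η` directly and `A * η` after mollification; `(A +
  -- 1) * η = ε / 2` leaves `ε / 2` for `g`.
  have hη : ε / 2 / (A + 1) ≠ 0 := by
    simp only [ne_eq, ENNReal.div_eq_zero_iff, not_or]
    exact ⟨⟨hε.ne', by simp⟩, hA1⟩
  obtain ⟨g, hgc, hgle, hgcont, hgm⟩ :=
    hu.exists_hasCompactSupport_eLpNorm_sub_le ENNReal.ofReal_ne_top hη
  have hcl := hρ.tendsto_eLpNorm_moll_sub_of_continuous hd h01 h1 hp hgcont hgc hb0
  rw [ENNReal.tendsto_nhds_zero] at hcl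
  filter_upwards [hcl (ε / 2) (pos_iff_ne_zero.2 hε2)] with n hn
  have hgl : LocallyIntegrable g := hgcont.locallyIntegrable
  have hum := hρ.aestronglyMeasurable hd h0 h01 hu.aestronglyMeasurable
  have hdm : AEStronglyMeasurable (u - g) := hum.sub hgcont.aestronglyMeasurable
  have hmm : AEStronglyMeasurable (moll (b n) (u - g)) :=
    (contDiff_moll (b n) (hul.sub hgl)).continuous.aestronglyMeasurable
  have hmg : AEStronglyMeasurable (moll (b n) g) :=
    (contDiff_moll (b n) hgl).continuous.aestronglyMeasurable
  have e : moll (b n) u - u = moll (b n) (u - g) + (moll (b n) g - g) - (u - g) := by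
    rw [moll_sub (b n) hul hgl]; abel
  rw [e]
  refine (eLpNorm_sub_le (aestronglyMeasurable_wMeasure
    (hmm.add (hmg.sub hgcont.aestronglyMeasurable))) (aestronglyMeasurable_wMeasure hdm) hP1).trans ?_
  refine (add_le_add_left (eLpNorm_add_le (aestronglyMeasurable_wMeasure hmm)
    (aestronglyMeasurable_wMeasure (hmg.sub hgcont.aestronglyMeasurable)) hP1) _).trans ?_
  calc _ ≤ A * (ε / 2 / (A + 1)) + ε / 2 + ε / 2 / (A + 1) := by
        refine add_le_add (add_le_add ((H (b n) (hb n) _ hdm hmm).trans ?_) hn) hgle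
        gcongr
    _ = (A + 1) * (ε / 2 / (A + 1)) + ε / 2 := by ring
    _ = ε := by
        rw [ENNReal.mul_div_cancel hA0 hA1, ENNReal.add_halves]

end Weight

/-! ### Mollification in the distributional equation. -/

theorem IsTest.moll {χ : Rd d → ℝ} (hχ : IsTest χ) (b : ContDiffBump (0 : Rd d)) :
    IsTest (moll b χ) :=
  ⟨contDiff_moll b hχ.continuous.locallyIntegrable,
    b.hasCompactSupport_normed.convolution _ hχ.2⟩

theorem normed_eq_zero (b : ContDiffBump (0 : Rd d)) {t : Rd d} (ht : b.rOut ≤ ‖t‖) :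
    b.normed volume t = 0 := by
  by_contra h
  have : t ∈ Function.support (b.normed volume) := h
  rw [b.support_normed_eq, mem_ball_zero_iff] at this
  linarith

/-- Mollification can be moved onto the test function in the distributional equation. -/
theorem IsDistribFracLap.integral_moll_mul_fracLap {s : ℝ} (hd : 0 < d) (hs0 : 0 < s)
    (hs1 : s < 1) {v f : Rd d → ℝ} (hvf : IsDistribFracLap s v f)
    (hvm : AEStronglyMeasurable v)
    (hv1 : Integrable (fun x => |v x| * (1 + ‖x‖) ^ (-((d : ℝ) + 2 * s))))
    (hf : LocallyIntegrable f) {χ : Rd d → ℝ} (hχ : IsTest χ) (b : ContDiffBump (0 : Rd d)) :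
    ∫ x, moll b v x * fracLap s χ x = ∫ x, f x * moll b χ x := by
  have hbc := continuous_normed b
  have hχc := hχ.continuous
  obtain ⟨A, hA0, hA⟩ := hχ.exists_fracLap_bound hd hs0 hs1
  have hLm := hχ.stronglyMeasurable_fracLap hd hs0 hs1
  have hfm : AEStronglyMeasurable f := hf.aestronglyMeasurable
  set q : ℝ := (d : ℝ) + 2 * s with hq
  have hq0 : 0 < q := by positivity
  set r := b.rOut with hr
  have hr0 : 0 < r := b.rOut_pos
  have hbi : Integrable (b.normed volume) := b.integrable_normed
  have hG : Integrable (fun z : Rd d × Rd d =>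
      b.normed volume z.1 * (v z.2 * fracLap s χ (z.2 + z.1))) (volume.prod volume) := by
    refine (hbi.mul_prod (hv1.const_mul (A * (1 + r) ^ q))).mono' ?_
      (Eventually.of_forall fun z => ?_)
    · refine hbc.aestronglyMeasurable.comp_fst.mul (hvm.comp_snd.mul ?_)
      exact (hLm.comp_measurable (by fun_prop)).aestronglyMeasurable
    · rw [norm_mul, Real.norm_of_nonneg (b.nonneg_normed z.1), norm_mul, Real.norm_eq_abs,
        Real.norm_eq_abs]
      rcases le_or_gt r ‖z.1‖ with h | h
      · rw [normed_eq_zero b h]; simp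
      refine mul_le_mul_of_nonneg_left ?_ (b.nonneg_normed z.1)
      -- Peetre's inequality: a shift of length less than `r` changes the decay by a bounded factor
      -- only.
      have h1 : 1 + ‖z.2‖ ≤ (1 + r) * (1 + ‖z.2 + z.1‖) := by
        have := norm_sub_le (z.2 + z.1) z.1
        rw [add_sub_cancel_right] at this
        nlinarith [norm_nonneg (z.2 + z.1)]
      have h2 : (1 + ‖z.2 + z.1‖) ^ (-q) ≤ (1 + r) ^ q * (1 + ‖z.2‖) ^ (-q) := by
        rw [Real.rpow_neg (by positivity), Real.rpow_neg (by positivity), ← div_eq_mul_inv,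
          ← one_div, div_le_div_iff₀ (by positivity) (by positivity), one_mul,
          ← Real.mul_rpow (by positivity) (by positivity)]
        exact Real.rpow_le_rpow (by positivity) h1 hq0.le
      calc |v z.2| * |fracLap s χ (z.2 + z.1)| ≤ |v z.2| * (A * (1 + ‖z.2 + z.1‖) ^ (-q)) := by
            gcongr; exact hA _
        _ ≤ |v z.2| * (A * ((1 + r) ^ q * (1 + ‖z.2‖) ^ (-q))) := by gcongr
        _ = _ := by ring
  -- The measure-preserving shear `(t, x) ↦ (t, x - t)` carries the previous integrand to this one.
  have hF : Integrable (fun z : Rd d × Rd d =>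
      b.normed volume z.1 * (v (z.2 - z.1) * fracLap s χ z.2)) (volume.prod volume) := by
    have := (measurePreserving_prod_neg_add (volume : Measure (Rd d))
      (volume : Measure (Rd d))).integrable_comp_of_integrable hG
    refine this.congr (Eventually.of_forall fun z => ?_)
    simp [neg_add_eq_sub]
  obtain ⟨M, hM⟩ := hχ.2.exists_bound_of_continuous hχc
  obtain ⟨R, hR⟩ := hχ.2.isCompact.isBounded.subset_closedBall 0
  have hM0 : 0 ≤ M := (norm_nonneg _).trans (hM 0)
  have hH : Integrable (fun z : Rd d × Rd d =>
      b.normed volume z.1 * (f z.2 * χ (z.2 + z.1))) (volume.prod volume) := by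
    have hfK : Integrable ((Metric.closedBall (0 : Rd d) (R + r)).indicator f) :=
      (integrable_indicator_iff Metric.isClosed_closedBall.measurableSet).2
        (hf.integrableOn_isCompact (isCompact_closedBall _ _))
    refine (hbi.mul_prod (hfK.norm.const_mul M)).mono' ?_ (Eventually.of_forall fun z => ?_)
    · refine hbc.aestronglyMeasurable.comp_fst.mul (hfm.comp_snd.mul ?_)
      exact Continuous.aestronglyMeasurable (by fun_prop)
    · rw [norm_mul, Real.norm_of_nonneg (b.nonneg_normed z.1), norm_mul]
      rcases le_or_gt r ‖z.1‖ with h | h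
      · rw [normed_eq_zero b h]; simp
      refine mul_le_mul_of_nonneg_left ?_ (b.nonneg_normed z.1)
      by_cases h1 : χ (z.2 + z.1) = 0
      · rw [h1, norm_zero, mul_zero]; positivity
      · have h2 := hR (subset_tsupport _ h1)
        rw [mem_closedBall_zero_iff] at h2
        have h3 := norm_sub_le (z.2 + z.1) z.1
        rw [add_sub_cancel_right] at h3
        rw [Set.indicator_of_mem (by rw [mem_closedBall_zero_iff]; linarith), mul_comm]
        exact mul_le_mul_of_nonneg_right (hM _) (norm_nonneg _)
  calc ∫ x, moll b v x * fracLap s χ x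
      = ∫ x, ∫ t, b.normed volume t * (v (x - t) * fracLap s χ x) := by
        congr 1; ext x
        rw [moll_apply, ← integral_mul_const]
        congr 1; ext t; ring
    _ = ∫ t, ∫ x, b.normed volume t * (v (x - t) * fracLap s χ x) :=
        (integral_integral_swap hF).symm
    _ = ∫ t, ∫ y, b.normed volume t * (f y * χ (y + t)) := by
        congr 1; ext t
        -- For each fixed `t` the equation is tested with the translate `χ (· + t)`, whose
        -- fractional Laplacian is the translated one. The evenness of the bump finally restores the
        -- convolution.
        rw [integral_const_mul, integral_const_mul, ← hvf _ (hχ.comp_add_right t),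
          ← integral_add_right_eq_self _ t]
        simp only [add_sub_cancel_right, hχ.fracLap_comp_add_right hd hs0 hs1]
    _ = ∫ y, ∫ t, b.normed volume t * (f y * χ (y + t)) := integral_integral_swap hH
    _ = ∫ y, f y * moll b χ y := by
        congr 1; ext y
        rw [moll_apply, ← integral_const_mul, ← integral_neg_eq_self]
        congr 1; ext t
        rw [b.normed_neg, ← sub_eq_add_neg]; ring

/-! ### Cutoff functions -/

/-- A fixed smooth bump equal to one on the unit ball. -/
def unitBump (d : ℕ) : ContDiffBump (0 : Rd d) := ⟨1, 2, one_pos, one_lt_two⟩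

/-- The unit bump dilated by `R`. -/
def cutoff (R : ℝ) (x : Rd d) : ℝ := unitBump d (R⁻¹ • x)

theorem isTest_unitBump : IsTest (unitBump d : Rd d → ℝ) :=
  ⟨(unitBump d).contDiff, (unitBump d).hasCompactSupport⟩

theorem isTest_cutoff {R : ℝ} (hR : 0 < R) : IsTest (cutoff R : Rd d → ℝ) :=
  ⟨isTest_unitBump.1.comp (contDiff_const_smul _),
    isTest_unitBump.2.comp_homeomorph (Homeomorph.smulOfNeZero R⁻¹ (inv_ne_zero hR.ne'))⟩

theorem cutoff_nonneg (R : ℝ) (x : Rd d) : 0 ≤ cutoff R x := (unitBump d).nonneg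

theorem cutoff_le_one (R : ℝ) (x : Rd d) : cutoff R x ≤ 1 := (unitBump d).le_one

theorem cutoff_eq_one {R : ℝ} (hR : 0 < R) {x : Rd d} (hx : ‖x‖ ≤ R) : cutoff R x = 1 := by
  refine (unitBump d).one_of_mem_closedBall ?_
  rw [mem_closedBall_zero_iff, norm_smul, norm_inv, Real.norm_of_nonneg hR.le,
    inv_mul_le_iff₀ hR]
  simpa [unitBump] using hx

theorem IsTest.mul_contDiff {ψ u : Rd d → ℝ} (hψ : IsTest ψ) (hu : ContDiff ℝ ∞ u) :
    IsTest (fun x => ψ x * u x) :=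
  ⟨hψ.1.mul hu, hψ.2.mul_right⟩

/-- By scaling, the quantity at `x` is `R^(-2s)` times that of the unit bump at `x/R`, which decays
like `(1+|x|/R)^(-d-2s)`. Weakening the decay to `-2s` produces exactly `(R+|x|)^(-2s)`, the weight
for which `u` is square integrable. -/
theorem exists_cutoff_sq_diff_bound {s : ℝ} (hd : 0 < d) (hs0 : 0 < s) (hs1 : s < 1) :
    ∃ A, 0 ≤ A ∧ ∀ R : ℝ, 1 ≤ R → ∀ x : Rd d,
      ∫ z, (cutoff R x - cutoff R (x + z)) ^ 2 / ‖z‖ ^ ((d : ℝ) + 2 * s) ≤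
        A * (R + ‖x‖) ^ (-(2 * s)) := by
  obtain ⟨A, hA0, hA⟩ := (isTest_unitBump (d := d)).exists_sq_diff_bound hd hs0 hs1
  refine ⟨A, hA0, fun R hR x => ?_⟩
  have hR0 : 0 < R := by linarith
  set q : ℝ := (d : ℝ) + 2 * s with hq
  let G : Rd d → ℝ := fun z =>
    (unitBump d (R⁻¹ • x) - unitBump d (R⁻¹ • x + z)) ^ 2 / ‖z‖ ^ q
  have e1 : ∀ z, (cutoff R x - cutoff R (x + z)) ^ 2 / ‖z‖ ^ q = R ^ (-q) * G (R⁻¹ • z) := by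
    intro z
    simp only [cutoff, G, smul_add]
    rw [norm_smul, norm_inv, Real.norm_of_nonneg hR0.le,
      Real.mul_rpow (by positivity) (norm_nonneg _), Real.inv_rpow hR0.le, Real.rpow_neg hR0.le]
    have : R ^ q ≠ 0 := (Real.rpow_pos_of_pos hR0 q).ne'
    rcases eq_or_ne (‖z‖ ^ q) 0 with h | h
    · rw [h]; simp
    · field_simp
  simp only [e1]
  rw [integral_const_mul, Measure.integral_comp_smul, finrank_Rd, smul_eq_mul, inv_pow, inv_inv,
    abs_of_pos (by positivity)]
  have h2 : R ^ (-q) * R ^ d = R ^ (-(2 * s)) := by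
    rw [← Real.rpow_natCast, ← Real.rpow_add hR0]; congr 1; rw [hq]; ring
  rw [← mul_assoc, h2]
  have hb : 1 ≤ 1 + ‖R⁻¹ • x‖ := by linarith [norm_nonneg (R⁻¹ • x)]
  have h3 : (1 + ‖R⁻¹ • x‖) ^ (-q) ≤ (1 + ‖R⁻¹ • x‖) ^ (-(2 * s)) :=
    Real.rpow_le_rpow_of_exponent_le hb (by rw [hq]; linarith [Nat.cast_nonneg (α := ℝ) d])
  have h4 : R ^ (-(2 * s)) * (1 + ‖R⁻¹ • x‖) ^ (-(2 * s)) = (R + ‖x‖) ^ (-(2 * s)) := by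
    rw [← Real.mul_rpow hR0.le (by positivity), norm_smul, norm_inv, Real.norm_of_nonneg hR0.le]
    congr 1
    field_simp
  calc R ^ (-(2 * s)) * ∫ z, G z ≤ R ^ (-(2 * s)) * (A * (1 + ‖R⁻¹ • x‖) ^ (-(2 * s))) := by
        gcongr
        exact (hA (R⁻¹ • x)).2.trans (by gcongr)
    _ = A * (R + ‖x‖) ^ (-(2 * s)) := by rw [← h4]; ring

/-! ### The commutator with a cutoff. -/

theorem integrable_sq_mul_of_le {s : ℝ} (hs0 : 0 < s) {u : Rd d → ℝ}
    (hum : AEStronglyMeasurable u)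
    (hu2 : Integrable (fun x => u x ^ 2 * (1 + ‖x‖) ^ (-(2 * s)))) {R : ℝ} (hR : 1 ≤ R) :
    Integrable (fun x => u x ^ 2 * (R + ‖x‖) ^ (-(2 * s))) := by
  refine hu2.mono' ((hum.pow 2).mul (Measurable.aestronglyMeasurable (by fun_prop)))
    (Eventually.of_forall fun x => ?_)
  have := norm_nonneg x
  rw [Real.norm_eq_abs, abs_of_nonneg (by positivity)]
  refine mul_le_mul_of_nonneg_left ?_ (sq_nonneg _)
  exact Real.rpow_le_rpow_of_nonpos (by positivity) (by linarith) (by linarith)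

theorem tendsto_integral_sq_mul {s : ℝ} (hs0 : 0 < s) {u : Rd d → ℝ}
    (hum : AEStronglyMeasurable u)
    (hu2 : Integrable (fun x => u x ^ 2 * (1 + ‖x‖) ^ (-(2 * s)))) :
    Tendsto (fun R : ℝ => ∫ x, u x ^ 2 * (R + ‖x‖) ^ (-(2 * s))) atTop (𝓝 0) := by
  have : (0 : ℝ) = ∫ _ : Rd d, (0 : ℝ) := by simp
  rw [this]
  refine tendsto_integral_filter_of_dominated_convergence _ ?_ ?_ hu2 ?_
  · exact Eventually.of_forall fun R =>
      (hum.pow 2).mul (Measurable.aestronglyMeasurable (by fun_prop))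
  · filter_upwards [eventually_ge_atTop 1] with R hR
    refine Eventually.of_forall fun x => ?_
    have := norm_nonneg x
    rw [Real.norm_eq_abs, abs_of_nonneg (by positivity)]
    refine mul_le_mul_of_nonneg_left ?_ (sq_nonneg _)
    exact Real.rpow_le_rpow_of_nonpos (by positivity) (by linarith) (by linarith)
  · refine Eventually.of_forall fun x => ?_
    have h1 : Tendsto (fun R : ℝ => (R + ‖x‖) ^ (-(2 * s))) atTop (𝓝 0) :=
      (tendsto_rpow_neg_atTop (by positivity)).comp (tendsto_atTop_add_const_right _ _ tendsto_id)
    simpa using h1.const_mul (u x ^ 2)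

/-- The energy of `ψ u` equals the pairing of `u` with `(-Δ)^s (ψ² u)` up to a commutator that is
controlled by the cutoff scale. -/
theorem exists_energy_cutoff_bound {s : ℝ} (hd : 0 < d) (hs0 : 0 < s) (hs1 : s < 1) :
    ∃ A, 0 ≤ A ∧ ∀ (u : Rd d → ℝ), ContDiff ℝ ∞ u →
      Integrable (fun x => u x ^ 2 * (1 + ‖x‖) ^ (-(2 * s))) → ∀ R : ℝ, 1 ≤ R →
      |fracConst d s / 2 * ∫ z, diffQuot s (fun x => cutoff R x * u x) z ^ 2
          ∂(volume.prod volume) -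
        ∫ x, u x * fracLap s (fun x => cutoff R x * (cutoff R x * u x)) x| ≤
      A * ∫ x, u x ^ 2 * (R + ‖x‖) ^ (-(2 * s)) := by
  obtain ⟨A, hA0, hA⟩ := exists_cutoff_sq_diff_bound hd hs0 hs1
  have hC := fracConst_pos (d := d) hs0 hs1
  refine ⟨fracConst d s / 2 * A, by positivity, ?_⟩
  intro u hu hu2 R hR
  have hR0 : 0 < R := by linarith
  have hψ : IsTest (cutoff R : Rd d → ℝ) := isTest_cutoff hR0
  have hψu : IsTest (fun x => cutoff R x * u x) := hψ.mul_contDiff hu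
  have hχ : IsTest (fun x => cutoff R x * (cutoff R x * u x)) := hψ.mul_contDiff hψu.1
  have hum : AEStronglyMeasurable u := hu.continuous.aestronglyMeasurable
  obtain ⟨A', -, hA'⟩ := hψ.exists_sq_diff_bound hd hs0 hs1
  set ψ : Rd d → ℝ := cutoff R with hψdef
  let h : Rd d → Rd d → ℝ := fun x y => (ψ x - ψ y) ^ 2 / ‖x - y‖ ^ ((d : ℝ) + 2 * s)
  have hh0 : ∀ x y, 0 ≤ h x y := fun x y => by positivity
  have hhs : ∀ x y, h x y = h y x := fun x y => by
    simp only [h]; rw [norm_sub_rev, ← neg_sub, neg_sq]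
  have hhx : ∀ x z, h x (x + z) = (ψ x - ψ (x + z)) ^ 2 / ‖z‖ ^ ((d : ℝ) + 2 * s) := by
    intro x z; simp only [h, sub_add_cancel_left, norm_neg]
  have hhm : Measurable (fun p : Rd d × Rd d => h p.1 p.2) := by
    have hc := hψ.continuous
    have h1 : Measurable fun z : Rd d × Rd d => (ψ z.1 - ψ z.2) ^ 2 :=
      Continuous.measurable (by fun_prop)
    exact h1.div (by fun_prop)
  obtain ⟨i1, b1⟩ := integrable_prod_mul_of_le (a := fun x => u x ^ 2)
    (B := fun x => A * (R + ‖x‖) ^ (-(2 * s))) (h := h) hhm.aestronglyMeasurable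
    (fun x => by simp only [hhx]; exact (hA' x).1)
    (fun x => by
      simp only [abs_of_nonneg (hh0 _ _)]
      simp only [hhx]
      exact hA R hR x)
    (hum.pow 2)
    (by
      refine ((integrable_sq_mul_of_le hs0 hum hu2 hR).const_mul A).congr
        (Eventually.of_forall fun x => ?_)
      simp only [abs_pow, sq_abs]; ring)
  have i2 : Integrable (fun p : Rd d × Rd d => u p.2 ^ 2 * h p.1 p.2) (volume.prod volume) := by
    refine i1.swap.congr (Eventually.of_forall fun p => ?_)
    simp only [Function.comp, Prod.fst_swap, Prod.snd_swap]
    rw [hhs]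
  have e2 : ∫ p, u p.2 ^ 2 * h p.1 p.2 ∂(volume.prod volume) =
      ∫ p, u p.1 ^ 2 * h p.1 p.2 ∂(volume.prod volume) := by
    rw [← integral_prod_swap]
    congr 1; ext p
    simp only [Prod.fst_swap, Prod.snd_swap]
    rw [hhs]
  -- The inequality `2|ab| ≤ a² + b²` and the symmetry of `h` reduce the commutator to a single
  -- integral of `u²`.
  have hpt : ∀ p : Rd d × Rd d, ‖u p.1 * u p.2 * h p.1 p.2‖ ≤
      1 / 2 * (u p.1 ^ 2 * h p.1 p.2 + u p.2 ^ 2 * h p.1 p.2) := by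
    intro p
    rw [Real.norm_eq_abs, abs_mul, abs_of_nonneg (hh0 _ _), ← add_mul, ← mul_assoc]
    refine mul_le_mul_of_nonneg_right ?_ (hh0 _ _)
    rw [abs_mul, ← sq_abs (u p.1), ← sq_abs (u p.2)]
    nlinarith [sq_nonneg (|u p.1| - |u p.2|)]
  have i3 : Integrable (fun p : Rd d × Rd d => u p.1 * u p.2 * h p.1 p.2) (volume.prod volume) :=
    ((i1.add i2).const_mul (1 / 2)).mono'
      ((hum.comp_fst.mul hum.comp_snd).mul hhm.aestronglyMeasurable) (Eventually.of_forall hpt)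
  have b3 : |∫ p, u p.1 * u p.2 * h p.1 p.2 ∂(volume.prod volume)| ≤
      A * ∫ x, u x ^ 2 * (R + ‖x‖) ^ (-(2 * s)) := by
    rw [← Real.norm_eq_abs]
    refine (norm_integral_le_of_norm_le ((i1.add i2).const_mul (1 / 2))
      (Eventually.of_forall hpt)).trans ?_
    simp only [Pi.add_apply]
    rw [integral_const_mul, integral_add i1 i2, e2, ← integral_const_mul A]
    have h5 : ∫ p, u p.1 ^ 2 * h p.1 p.2 ∂(volume.prod volume) ≤
        ∫ x, A * (u x ^ 2 * (R + ‖x‖) ^ (-(2 * s))) := by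
      refine le_trans (integral_mono i1 i1.abs fun p => le_abs_self _) (b1.trans (le_of_eq ?_))
      congr 1; ext x
      simp only [abs_pow, sq_abs]; ring
    linarith
  have i4 : Integrable (fun z => diffQuot s (fun x => ψ x * u x) z ^ 2) (volume.prod volume) :=
    (hψu.memLp_diffQuot hd hs0 hs1).integrable_sq
  -- The algebraic identity behind the proof; testing with `ψ² u` rather than `ψ u` is what produces
  -- a perfect square.
  have hid : ∀ z : Rd d × Rd d,
      gagliardoIntegrand s u (fun x => ψ x * (ψ x * u x)) z.1 z.2 =
      diffQuot s (fun x => ψ x * u x) z ^ 2 - u z.1 * u z.2 * h z.1 z.2 := by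
    intro z
    rw [pow_two, diffQuot_mul_diffQuot hs0]
    simp only [gagliardoIntegrand, h]
    ring
  have i5 : Integrable (fun z : Rd d × Rd d =>
      gagliardoIntegrand s u (fun x => ψ x * (ψ x * u x)) z.1 z.2) (volume.prod volume) := by
    simp only [hid]
    exact i4.sub i3
  rw [hχ.integral_mul_fracLap hd hs0 hs1 hum (integrable_abs_mul_of_sq hs0 hum hu2) i5]
  simp only [hid]
  rw [integral_sub i4 i3, ← mul_sub, sub_sub_cancel, abs_mul, abs_of_pos (by positivity),
    mul_assoc]
  exact mul_le_mul_of_nonneg_left b3 (by positivity)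

/-! ### Approximation by test functions -/

/-- Write `ψU - v = ψ(U - v) + (ψv - v)`: the first term is a contraction of `U - v`, the second
tends to zero by dominated convergence. Letting `U` vary with `n` allows a second cutoff, for `ψ²
u`. -/
theorem tendsto_eLpNorm_cutoff_sub {μ : Measure (Rd d)} {p : ℝ} (hp : 1 ≤ p) {v : Rd d → ℝ}
    (hv : MemLp v (ENNReal.ofReal p) μ) {R : ℕ → ℝ} (hR : Tendsto R atTop atTop)
    {U : ℕ → Rd d → ℝ} (hU : ∀ n, AEStronglyMeasurable (U n) μ)
    (hlim : Tendsto (fun n => eLpNorm (U n - v) (ENNReal.ofReal p) μ) atTop (𝓝 0)) :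
    Tendsto (fun n => eLpNorm ((fun x => cutoff (R n) x * U n x) - v) (ENNReal.ofReal p) μ)
      atTop (𝓝 0) := by
  have hp0 : 0 < p := by linarith
  have hP1 : (1 : ENNReal) ≤ ENNReal.ofReal p := by simpa using hp
  have hcm : ∀ n, AEStronglyMeasurable (cutoff (R n) : Rd d → ℝ) μ := fun n =>
    ((unitBump d).continuous.comp (continuous_const_smul _)).aestronglyMeasurable
  have h1 : Tendsto (fun n => eLpNorm (fun x => cutoff (R n) x * v x - v x) (ENNReal.ofReal p) μ)
      atTop (𝓝 0) := by
    have hmeas : ∀ n, AEStronglyMeasurable (fun x => cutoff (R n) x * v x - v x) μ := fun n =>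
      ((hcm n).mul hv.1).sub hv.1
    have hle : ∀ n x, ‖cutoff (R n) x * v x - v x‖ ≤ ‖v x‖ := by
      intro n x
      have e : cutoff (R n) x * v x - v x = -((1 - cutoff (R n) x) * v x) := by ring
      rw [e, norm_neg, norm_mul, Real.norm_of_nonneg (by linarith [cutoff_le_one (R n) x])]
      exact mul_le_of_le_one_left (norm_nonneg _) (by linarith [cutoff_nonneg (R n) x])
    have hfin : ∫⁻ x, ‖v x‖ₑ ^ p ∂μ ≠ ⊤ := by
      have := lintegral_rpow_enorm_lt_top_of_eLpNorm_lt_top (by simpa using hp0)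
        ENNReal.ofReal_ne_top hv.2
      rw [ENNReal.toReal_ofReal hp0.le] at this
      exact this.ne
    have hT : Tendsto (fun n => ∫⁻ x, ‖cutoff (R n) x * v x - v x‖ₑ ^ p ∂μ) atTop (𝓝 0) := by
      have h0 : (0 : ENNReal) = ∫⁻ _, 0 ∂μ := by simp
      rw [h0]
      refine tendsto_lintegral_of_dominated_convergence' _
        (fun n => (hmeas n).enorm.pow_const p) (fun n => Eventually.of_forall fun x => ?_) hfin
        (Eventually.of_forall fun x => ?_)
      · exact ENNReal.rpow_le_rpow (enorm_le_iff_norm_le.2 (hle n x)) hp0.le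
      · refine tendsto_const_nhds.congr' ?_
        filter_upwards [hR.eventually_ge_atTop ‖x‖, hR.eventually_gt_atTop 0] with n hn hn0
        rw [cutoff_eq_one hn0 hn, one_mul, sub_self, enorm_zero, ENNReal.zero_rpow_of_pos hp0]
    have hT2 := (ENNReal.continuous_rpow_const (y := 1 / p)).tendsto 0 |>.comp hT
    rw [ENNReal.zero_rpow_of_pos (by positivity)] at hT2
    refine hT2.congr fun n => ?_
    rw [eLpNorm_eq_lintegral_rpow_enorm_toReal (by simpa using hp0) ENNReal.ofReal_ne_top,
      ENNReal.toReal_ofReal hp0.le]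
    rfl
  have hsum := hlim.add h1
  rw [add_zero] at hsum
  refine tendsto_of_tendsto_of_tendsto_of_le_of_le tendsto_const_nhds hsum
    (fun n => zero_le) fun n => ?_
  have e : ((fun x => cutoff (R n) x * U n x) - v) =
      (fun x => cutoff (R n) x * (U n - v) x) + fun x => cutoff (R n) x * v x - v x := by
    ext x; simp only [Pi.sub_apply, Pi.add_apply]; ring
  simp only [e]
  refine (eLpNorm_add_le ((hcm n).mul ((hU n).sub hv.1)) (((hcm n).mul hv.1).sub hv.1)
    hP1).trans (add_le_add_left (eLpNorm_mono fun x => ?_) _)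
  rw [Pi.mul_apply, norm_mul, Real.norm_of_nonneg (cutoff_nonneg _ _)]
  exact mul_le_of_le_one_left (norm_nonneg _) (cutoff_le_one _ _)

/-- The bump functions used for mollification. -/
def smallBump (d n : ℕ) : ContDiffBump (0 : Rd d) :=
  ⟨1 / ((n : ℝ) + 1), 2 * (1 / ((n : ℝ) + 1)), by positivity, by
    have : 0 < 1 / ((n : ℝ) + 1) := by positivity
    linarith⟩

theorem smallBump_rOut (n : ℕ) : (smallBump d n).rOut = 2 * (smallBump d n).rIn := rfl

theorem tendsto_smallBump_rOut : Tendsto (fun n => (smallBump d n).rOut) atTop (𝓝 0) := by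
  have := (tendsto_one_div_add_atTop_nhds_zero_nat (𝕜 := ℝ)).const_mul 2
  rwa [mul_zero] at this

/-! ### Approximation in the energy norm. -/

section Weight

variable {ρ : Rd d → ℝ} {γ₀ γ c C : ℝ}

theorem IsTest.memLpWeight {φ : Rd d → ℝ} (hφ : IsTest φ) (hρ : IsWeight ρ γ₀ γ c C) (hd : 0 < d)
    (h01 : γ₀ ≤ γ) (h1 : γ < d) (p : ℝ) : MemLpWeight p ρ φ := by
  have := hρ.isLocallyFiniteMeasure hd h01 h1
  exact hφ.continuous.memLp_of_hasCompactSupport hφ.2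

/-- Hölder's inequality against the indicator of a compact set, which has finite weighted measure.
-/
theorem IsWeight.locallyIntegrable_of_inv_mul (hρ : IsWeight ρ γ₀ γ c C) (hd : 0 < d)
    (h0 : 0 ≤ γ₀) (h01 : γ₀ ≤ γ) (h1 : γ < d) {p : ℝ} (hp : 1 < p) {f : Rd d → ℝ}
    (hf : MemLpWeight (p / (p - 1)) ρ (fun x => (ρ x)⁻¹ * f x)) : LocallyIntegrable f := by
  have := hρ.isLocallyFiniteMeasure hd h01 h1
  rw [locallyIntegrable_iff]
  intro K hK
  have hm : MemLpWeight p ρ (K.indicator fun _ => (1 : ℝ)) :=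
    memLp_indicator_const _ hK.measurableSet _ (Or.inr hK.measure_lt_top.ne)
  have := hρ.integrable_mul hd h0 h01 hp hf hm
  rw [← integrable_indicator_iff hK.measurableSet]
  refine this.congr (Eventually.of_forall fun x => ?_)
  by_cases hx : x ∈ K <;> simp [hx]

/-- Cut-off mollifications converge in `L^p_ρ`, almost everywhere, and in energy. -/
theorem IsWeight.exists_test_approx (hρ : IsWeight ρ γ₀ γ c C) (h0 : 0 ≤ γ₀)
    (h01 : γ₀ ≤ γ) {s p : ℝ} (hs0 : 0 < s) (hs1 : s < 1) (hds : 2 * s < (d : ℝ))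
    (h2 : γ < 2 * s) (hp0 : 2 ≤ p) (hp1 : p < 2 * ((d : ℝ) - γ) / ((d : ℝ) - 2 * s))
    {v f : Rd d → ℝ} (hv : MemLpWeight p ρ v) (hvf : IsDistribFracLap s v f)
    (hf : MemLpWeight (p / (p - 1)) ρ (fun x => (ρ x)⁻¹ * f x)) :
    ∃ φ : ℕ → Rd d → ℝ, (∀ n, IsTest (φ n)) ∧
      Tendsto (fun n => eLpNorm (φ n - v) (ENNReal.ofReal p) (wMeasure ρ)) atTop (𝓝 0) ∧
      (∀ᵐ x, Tendsto (fun n => φ n x) atTop (𝓝 (v x))) ∧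
      Tendsto (fun n => fracConst d s / 2 * ∫ z, diffQuot s (φ n) z ^ 2 ∂(volume.prod volume))
        atTop (𝓝 (∫ x, f x * v x)) := by
  have hd := pos_of_two_mul_lt hs0 hds
  have h1 : γ < d := by linarith
  have hp : 1 < p := by linarith
  have hvm := hρ.aestronglyMeasurable hd h0 h01 hv.aestronglyMeasurable
  have hvl := hρ.locallyIntegrable hd h0 h01 h1 hp.le hv
  have hv2 := hρ.integrable_sq_mul h0 h01 hs0 hds hp0 hp1 hv
  have hfl := hρ.locallyIntegrable_of_inv_mul hd h0 h01 h1 hp hf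
  have hP1 : (1 : ENNReal) ≤ ENNReal.ofReal p := by simpa using hp.le
  have hP0 : ENNReal.ofReal p ≠ 0 := by simp; linarith
  let u : ℕ → Rd d → ℝ := fun n => moll (smallBump d n) v
  have hus : ∀ n, ContDiff ℝ ∞ (u n) := fun n => contDiff_moll _ hvl
  have huL : ∀ n, MemLpWeight p ρ (u n) := fun n =>
    hρ.memLp_moll hd h0 h01 h1 hp.le hv (smallBump_rOut n)
  have hu2 : ∀ n, Integrable (fun x => u n x ^ 2 * (1 + ‖x‖) ^ (-(2 * s))) := fun n =>
    hρ.integrable_sq_mul h0 h01 hs0 hds hp0 hp1 (huL n)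
  obtain ⟨A, hA0, hA⟩ := exists_energy_cutoff_bound (d := d) hd hs0 hs1
  -- The cutoff scale is chosen after the mollification, large enough for the commutator to be below
  -- `1/(n+1)`. No uniformity in `n` of the weighted `L²` norms is needed.
  have hRex : ∀ n : ℕ, ∃ R : ℝ, (n : ℝ) + 1 ≤ R ∧
      A * ∫ x, u n x ^ 2 * (R + ‖x‖) ^ (-(2 * s)) < 1 / ((n : ℝ) + 1) := by
    intro n
    have hT := (tendsto_integral_sq_mul hs0 (hus n).continuous.aestronglyMeasurable
      (hu2 n)).const_mul A
    rw [mul_zero] at hT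
    exact ((eventually_ge_atTop _).and
      (hT.eventually (gt_mem_nhds (by positivity)))).exists
  choose R hRn hRA using hRex
  have hR1 : ∀ n, 1 ≤ R n := fun n => by linarith [hRn n, Nat.cast_nonneg (α := ℝ) n]
  have hRT : Tendsto R atTop atTop :=
    tendsto_atTop_mono hRn (tendsto_atTop_add_const_right _ _ tendsto_natCast_atTop_atTop)
  let φ : ℕ → Rd d → ℝ := fun n x => cutoff (R n) x * u n x
  let χ : ℕ → Rd d → ℝ := fun n x => cutoff (R n) x * φ n x
  have hφt : ∀ n, IsTest (φ n) := fun n =>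
    (isTest_cutoff (by linarith [hR1 n])).mul_contDiff (hus n)
  have hχt : ∀ n, IsTest (χ n) := fun n =>
    (isTest_cutoff (by linarith [hR1 n])).mul_contDiff (hφt n).1
  have hulim : Tendsto (fun n => eLpNorm (u n - v) (ENNReal.ofReal p) (wMeasure ρ)) atTop (𝓝 0) :=
    hρ.tendsto_eLpNorm_moll_sub hd h0 h01 h1 hp.le hv smallBump_rOut tendsto_smallBump_rOut
  have hφlim : Tendsto (fun n => eLpNorm (φ n - v) (ENNReal.ofReal p) (wMeasure ρ)) atTop (𝓝 0) :=
    tendsto_eLpNorm_cutoff_sub hp.le hv hRT (fun n => (huL n).1) hulim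
  have hχlim : Tendsto (fun n => eLpNorm (χ n - v) (ENNReal.ofReal p) (wMeasure ρ)) atTop (𝓝 0) :=
    tendsto_eLpNorm_cutoff_sub hp.le hv hRT
      (fun n => (hφt n).continuous.aestronglyMeasurable) hφlim
  -- The test functions are mollified once more because the mollifier has moved off `v`. Uniform
  -- boundedness gives the limit although bump and function vary together.
  have hmlim : Tendsto (fun n => eLpNorm (moll (smallBump d n) (χ n) - v) (ENNReal.ofReal p)
      (wMeasure ρ)) atTop (𝓝 0) := by
    obtain ⟨B, hB, H⟩ := hρ.exists_eLpNorm_moll_le hd h0 h01 h1 hp.le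
    have hT := (ENNReal.Tendsto.const_mul hχlim (Or.inr hB)).add hulim
    rw [mul_zero, add_zero] at hT
    refine tendsto_of_tendsto_of_tendsto_of_le_of_le tendsto_const_nhds hT
      (fun n => zero_le) fun n => ?_
    have hχl : LocallyIntegrable (χ n) := (hχt n).continuous.locallyIntegrable
    have hm1 : AEStronglyMeasurable (moll (smallBump d n) (χ n - v)) :=
      (contDiff_moll _ (hχl.sub hvl)).continuous.aestronglyMeasurable
    have e : moll (smallBump d n) (χ n) - v = moll (smallBump d n) (χ n - v) + (u n - v) := by
      rw [moll_sub _ hχl hvl]; simp only [u]; abel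
    simp only [e]
    refine (eLpNorm_add_le (aestronglyMeasurable_wMeasure hm1) ((huL n).1.sub hv.1) hP1).trans
      (add_le_add_left (H _ (smallBump_rOut n) _
        ((hχt n).continuous.aestronglyMeasurable.sub hvm) hm1) _)
  have hpair : Tendsto (fun n => ∫ x, f x * moll (smallBump d n) (χ n) x) atTop
      (𝓝 (∫ x, f x * v x)) :=
    hρ.tendsto_integral_mul hd h0 h01 hp hf hv
      (fun n => ((hχt n).moll _).memLpWeight hρ hd h01 h1 p) hmlim
  have hE : Tendsto (fun n => fracConst d s / 2 *
      ∫ z, diffQuot s (φ n) z ^ 2 ∂(volume.prod volume)) atTop (𝓝 (∫ x, f x * v x)) := by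
    have hdiff : Tendsto (fun n => fracConst d s / 2 *
        ∫ z, diffQuot s (φ n) z ^ 2 ∂(volume.prod volume) -
        ∫ x, f x * moll (smallBump d n) (χ n) x) atTop (𝓝 0) := by
      refine squeeze_zero_norm (fun n => ?_) (tendsto_one_div_add_atTop_nhds_zero_nat (𝕜 := ℝ))
      have h3 := hA (u n) (hus n) (hu2 n) (R n) (hR1 n)
      rw [hvf.integral_moll_mul_fracLap hd hs0 hs1 hvm (integrable_abs_mul_of_sq hs0 hvm hv2)
        hfl (hχt n)] at h3
      exact h3.trans (hRA n).le
    simpa using hdiff.add hpair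
  -- A subsequence converges almost everywhere, as Fatou's lemma will require.
  obtain ⟨ns, hns, hae⟩ := (tendstoInMeasure_of_tendsto_eLpNorm hP0
    (fun n => (hφt n).continuous.aestronglyMeasurable) hv.1 hφlim).exists_seq_tendsto_ae
  exact ⟨fun n => φ (ns n), fun n => hφt _, hφlim.comp hns.tendsto_atTop,
    (hρ.volume_absolutelyContinuous hd h0 h01).ae_le hae, hE.comp hns.tendsto_atTop⟩

theorem lintegral_diffQuot_sq_le_of_tendsto {s : ℝ} {v : Rd d → ℝ} {φ : ℕ → Rd d → ℝ}
    (hφm : ∀ n, AEStronglyMeasurable (φ n))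
    (hφ : ∀ n, MemLp (diffQuot s (φ n)) 2 (volume.prod volume))
    (hae : ∀ᵐ x, Tendsto (fun n => φ n x) atTop (𝓝 (v x))) {a : ℝ}
    (hlim : Tendsto (fun n => ∫ z, diffQuot s (φ n) z ^ 2 ∂(volume.prod volume)) atTop (𝓝 a)) :
    ∫⁻ z, ENNReal.ofReal (diffQuot s v z ^ 2) ∂(volume.prod volume) ≤ ENNReal.ofReal a := by
  have hconv : ∀ᵐ z : Rd d × Rd d ∂(volume.prod volume),
      Tendsto (fun n => ENNReal.ofReal (diffQuot s (φ n) z ^ 2)) atTop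
        (𝓝 (ENNReal.ofReal (diffQuot s v z ^ 2))) := by
    filter_upwards [Measure.quasiMeasurePreserving_fst.ae hae,
      Measure.quasiMeasurePreserving_snd.ae hae] with z hz1 hz2
    exact ENNReal.tendsto_ofReal (((hz1.sub hz2).mul_const _).pow 2)
  have hm : ∀ n, AEMeasurable (fun z => ENNReal.ofReal (diffQuot s (φ n) z ^ 2))
      (volume.prod volume) := fun n =>
    ((aestronglyMeasurable_diffQuot s (hφm n)).pow 2).aemeasurable.ennreal_ofReal
  calc _ = ∫⁻ z, liminf (fun n => ENNReal.ofReal (diffQuot s (φ n) z ^ 2)) atTop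
        ∂(volume.prod volume) := lintegral_congr_ae (hconv.mono fun z hz => hz.liminf_eq.symm)
    _ ≤ liminf (fun n => ∫⁻ z, ENNReal.ofReal (diffQuot s (φ n) z ^ 2) ∂(volume.prod volume))
        atTop := lintegral_liminf_le' hm
    _ = ENNReal.ofReal a := by
        refine Tendsto.liminf_eq ((ENNReal.tendsto_ofReal hlim).congr fun n => ?_)
        exact ofReal_integral_eq_lintegral_ofReal (hφ n).integrable_sq
          (Eventually.of_forall fun z => sq_nonneg _)

/-- Functions in the domain have finite energy and are limits of test functions, in the energy
norm and in `L^p_ρ` simultaneously. -/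
theorem IsWeight.exists_test_approx_energy (hρ : IsWeight ρ γ₀ γ c C) (h0 : 0 ≤ γ₀)
    (h01 : γ₀ ≤ γ) {s p : ℝ} (hs0 : 0 < s) (hs1 : s < 1) (hds : 2 * s < (d : ℝ))
    (h2 : γ < 2 * s) (hp0 : 2 ≤ p) (hp1 : p < 2 * ((d : ℝ) - γ) / ((d : ℝ) - 2 * s))
    {v f : Rd d → ℝ} (hv : MemLpWeight p ρ v) (hvf : IsDistribFracLap s v f)
    (hf : MemLpWeight (p / (p - 1)) ρ (fun x => (ρ x)⁻¹ * f x)) :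
    MemLp (diffQuot s v) 2 (volume.prod volume) ∧
    ∃ φ : ℕ → Rd d → ℝ, (∀ n, IsTest (φ n)) ∧
      Tendsto (fun n => eLpNorm (φ n - v) (ENNReal.ofReal p) (wMeasure ρ)) atTop (𝓝 0) ∧
      Tendsto (fun n => ∫ z, (diffQuot s v z - diffQuot s (φ n) z) ^ 2 ∂(volume.prod volume))
        atTop (𝓝 0) := by
  have hd := pos_of_two_mul_lt hs0 hds
  have h1 : γ < d := by linarith
  have hp : 1 < p := by linarith
  have hC := fracConst_pos (d := d) hs0 hs1
  have hvm := hρ.aestronglyMeasurable hd h0 h01 hv.aestronglyMeasurable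
  have hv2 := hρ.integrable_sq_mul h0 h01 hs0 hds hp0 hp1 hv
  obtain ⟨φ, hφt, hφlim, hae, hE⟩ :=
    hρ.exists_test_approx h0 h01 hs0 hs1 hds h2 hp0 hp1 hv hvf hf
  set I := ∫ x, f x * v x with hI
  clear_value I
  have hφE := fun n => (hφt n).memLp_diffQuot hd hs0 hs1
  have hE' : Tendsto (fun n => ∫ z, diffQuot s (φ n) z ^ 2 ∂(volume.prod volume)) atTop
      (𝓝 (2 / fracConst d s * I)) := by
    refine (hE.const_mul (2 / fracConst d s)).congr fun n => ?_
    field_simp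
  have hI0 : 0 ≤ 2 / fracConst d s * I :=
    ge_of_tendsto' hE' fun n => integral_nonneg fun z => sq_nonneg _
  have hFatou := lintegral_diffQuot_sq_le_of_tendsto
    (fun n => (hφt n).continuous.aestronglyMeasurable) hφE hae hE'
  have hdm := aestronglyMeasurable_diffQuot s hvm
  have hint : Integrable (fun z => diffQuot s v z ^ 2) (volume.prod volume) := by
    refine ⟨hdm.pow 2, ?_⟩
    rw [hasFiniteIntegral_iff_ofReal (Eventually.of_forall fun z => sq_nonneg _)]
    exact hFatou.trans_lt ENNReal.ofReal_lt_top
  have hvE : MemLp (diffQuot s v) 2 (volume.prod volume) :=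
    (memLp_two_iff_integrable_sq hdm).2 hint
  -- Only this inequality for the energy of `v` is needed; equality is a consequence of the strong
  -- convergence below.
  have hle : ∫ z, diffQuot s v z ^ 2 ∂(volume.prod volume) ≤ 2 / fracConst d s * I := by
    rw [← ofReal_integral_eq_lintegral_ofReal hint (Eventually.of_forall fun z => sq_nonneg _)]
      at hFatou
    exact (ENNReal.ofReal_le_ofReal_iff hI0).1 hFatou
  -- Finite energy of `v` makes the form against `φ n` absolutely convergent, so the weak
  -- formulation identifies it with `∫ f φ_n`, which converges by Hölder's inequality.
  have hcross : Tendsto (fun n => ∫ z, diffQuot s v z * diffQuot s (φ n) z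
      ∂(volume.prod volume)) atTop (𝓝 (2 / fracConst d s * I)) := by
    have hT := hρ.tendsto_integral_mul hd h0 h01 hp hf hv
      (fun n => (hφt n).memLpWeight hρ hd h01 h1 p) hφlim
    rw [← hI] at hT
    refine (hT.const_mul (2 / fracConst d s)).congr fun n => ?_
    rw [← hvf _ (hφt n), (hφt n).integral_mul_fracLap hd hs0 hs1 hvm
      (integrable_abs_mul_of_sq hs0 hvm hv2) (integrable_gagliardoIntegrand hs0 hvE (hφE n))]
    simp only [diffQuot_mul_diffQuot hs0]
    field_simp
  refine ⟨hvE, φ, hφt, hφlim, ?_⟩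
  -- Expansion of the square with the energy of `v` replaced by its upper bound: the limit is `J -
  -- 2J + J = 0`, where `J = 2I/C_{d,s}`.
  have hlim : Tendsto (fun n => 2 / fracConst d s * I -
      2 * ∫ z, diffQuot s v z * diffQuot s (φ n) z ∂(volume.prod volume) +
      ∫ z, diffQuot s (φ n) z ^ 2 ∂(volume.prod volume)) atTop (𝓝 0) := by
    have := (tendsto_const_nhds (x := 2 / fracConst d s * I)).sub (hcross.const_mul 2) |>.add hE'
    refine this.trans (le_of_eq ?_)
    congr 1; ring
  refine squeeze_zero (fun n => integral_nonneg fun z => sq_nonneg _) (fun n => ?_) hlim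
  have i1 : Integrable (fun z => diffQuot s v z * diffQuot s (φ n) z) (volume.prod volume) :=
    hvE.integrable_mul (hφE n)
  have e : ∫ z, (diffQuot s v z - diffQuot s (φ n) z) ^ 2 ∂(volume.prod volume) =
      ∫ z, diffQuot s v z ^ 2 ∂(volume.prod volume) -
      2 * ∫ z, diffQuot s v z * diffQuot s (φ n) z ∂(volume.prod volume) +
      ∫ z, diffQuot s (φ n) z ^ 2 ∂(volume.prod volume) := by
    have i2 : Integrable (fun z => diffQuot s v z ^ 2 -
        2 * (diffQuot s v z * diffQuot s (φ n) z)) (volume.prod volume) :=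
      hint.sub (i1.const_mul 2)
    rw [← integral_const_mul, ← integral_sub hint (i1.const_mul 2),
      ← integral_add i2 (hφE n).integrable_sq]
    congr 1; ext z; ring
  rw [e]; linarith

/-- One sequence serves both requirements: its energy convergence is known, and its `L^p_ρ`
convergence implies local `L¹` convergence because the weight is bounded below on compact sets. -/
theorem IsWeight.memHdot (hρ : IsWeight ρ γ₀ γ c C) (h0 : 0 ≤ γ₀)
    (h01 : γ₀ ≤ γ) {s p : ℝ} (hs0 : 0 < s) (hs1 : s < 1) (hds : 2 * s < (d : ℝ))
    (h2 : γ < 2 * s) (hp0 : 2 ≤ p) (hp1 : p < 2 * ((d : ℝ) - γ) / ((d : ℝ) - 2 * s))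
    {v f : Rd d → ℝ} (hv : MemLpWeight p ρ v) (hvf : IsDistribFracLap s v f)
    (hf : MemLpWeight (p / (p - 1)) ρ (fun x => (ρ x)⁻¹ * f x)) : MemHdot s v := by
  have hd := pos_of_two_mul_lt hs0 hds
  have h1 : γ < d := by linarith
  have hp : 1 ≤ p := by linarith
  have hvm := hρ.aestronglyMeasurable hd h0 h01 hv.aestronglyMeasurable
  obtain ⟨hvE, φ, hφt, hφlim, hE⟩ :=
    hρ.exists_test_approx_energy h0 h01 hs0 hs1 hds h2 hp0 hp1 hv hvf hf
  refine ⟨hρ.locallyIntegrable hd h0 h01 h1 hp hv, φ, hφt, ?_, ?_⟩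
  · have hT := ENNReal.Tendsto.const_mul (a := ENNReal.ofReal (fracConst d s / 2))
      (ENNReal.tendsto_ofReal hE) (Or.inr ENNReal.ofReal_ne_top)
    rw [ENNReal.ofReal_zero, mul_zero] at hT
    refine hT.congr fun n => ?_
    have hm : AEStronglyMeasurable (fun x => v x - φ n x) :=
      hvm.sub (hφt n).continuous.aestronglyMeasurable
    have hsub : MemLp (fun z => diffQuot s v z - diffQuot s (φ n) z) 2 (volume.prod volume) :=
      hvE.sub ((hφt n).memLp_diffQuot hd hs0 hs1)
    rw [hdotNormSq_eq hs0 hm, diffQuot_sub, ofReal_integral_eq_lintegral_ofReal hsub.integrable_sq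
        (Eventually.of_forall fun z => sq_nonneg _)]
    rfl
  · intro K hK
    obtain ⟨A, hA, H⟩ := hρ.exists_lintegral_le hd h0 h01 h1 hp hK
    have hT := ENNReal.Tendsto.const_mul (a := A) hφlim (Or.inr hA)
    rw [mul_zero] at hT
    refine tendsto_of_tendsto_of_tendsto_of_le_of_le tendsto_const_nhds hT
      (fun n => zero_le) fun n => ?_
    refine le_of_eq_of_le ?_ (H (φ n - v) ((hφt n).continuous.aestronglyMeasurable.sub hvm))
    congr 1; ext x
    rw [Pi.sub_apply, ← enorm_neg, neg_sub]

/-- Integration by parts for two functions in the domain. -/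
theorem IsWeight.integral_mul_eq_gagliardo (hρ : IsWeight ρ γ₀ γ c C) (h0 : 0 ≤ γ₀)
    (h01 : γ₀ ≤ γ) {s p : ℝ} (hs0 : 0 < s) (hs1 : s < 1) (hds : 2 * s < (d : ℝ))
    (h2 : γ < 2 * s) (hp0 : 2 ≤ p) (hp1 : p < 2 * ((d : ℝ) - γ) / ((d : ℝ) - 2 * s))
    {v f w g : Rd d → ℝ} (hv : MemLpWeight p ρ v) (hvf : IsDistribFracLap s v f)
    (hf : MemLpWeight (p / (p - 1)) ρ (fun x => (ρ x)⁻¹ * f x))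
    (hw : MemLpWeight p ρ w) (hwg : IsDistribFracLap s w g)
    (hg : MemLpWeight (p / (p - 1)) ρ (fun x => (ρ x)⁻¹ * g x)) :
    ∫ x, g x * v x =
      fracConst d s / 2 * ∫ z, gagliardoIntegrand s w v z.1 z.2 ∂(volume.prod volume) := by
  have hd := pos_of_two_mul_lt hs0 hds
  have h1 : γ < d := by linarith
  have hp : 1 < p := by linarith
  have hwm := hρ.aestronglyMeasurable hd h0 h01 hw.aestronglyMeasurable
  have hw2 := hρ.integrable_sq_mul h0 h01 hs0 hds hp0 hp1 hw
  obtain ⟨hvE, φ, hφt, hφlim, hE⟩ :=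
    hρ.exists_test_approx_energy h0 h01 hs0 hs1 hds h2 hp0 hp1 hv hvf hf
  have hwE := (hρ.exists_test_approx_energy h0 h01 hs0 hs1 hds h2 hp0 hp1 hw hwg hg).1
  have hφE := fun n => (hφt n).memLp_diffQuot hd hs0 hs1
  have T1 := hρ.tendsto_integral_mul hd h0 h01 hp hg hv
    (fun n => (hφt n).memLpWeight hρ hd h01 h1 p) hφlim
  -- The Cauchy–Schwarz bound for the form of `w` against `v - φ_n`.
  have hbd : Tendsto (fun n => (∫ z, diffQuot s w z ^ 2 ∂(volume.prod volume)) ^ (1 / 2 : ℝ) *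
      (∫ z, (diffQuot s v z - diffQuot s (φ n) z) ^ 2 ∂(volume.prod volume)) ^ (1 / 2 : ℝ))
      atTop (𝓝 0) := by
    have h3 := (hE.rpow_const (p := 1 / 2) (Or.inr (by norm_num))).const_mul
      ((∫ z, diffQuot s w z ^ 2 ∂(volume.prod volume)) ^ (1 / 2 : ℝ))
    rwa [Real.zero_rpow (by norm_num), mul_zero] at h3
  have T2 : Tendsto (fun n => ∫ z, gagliardoIntegrand s w (φ n) z.1 z.2 ∂(volume.prod volume))
      atTop (𝓝 (∫ z, gagliardoIntegrand s w v z.1 z.2 ∂(volume.prod volume))) := by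
    rw [tendsto_iff_norm_sub_tendsto_zero]
    refine squeeze_zero (fun n => norm_nonneg _) (fun n => ?_) hbd
    have hsub : MemLp (fun z => diffQuot s v z - diffQuot s (φ n) z) 2 (volume.prod volume) :=
      hvE.sub (hφE n)
    have hH := integral_mul_norm_le_Lp_mul_Lq (μ := (volume : Measure (Rd d)).prod volume)
      (f := diffQuot s w) (g := fun z => diffQuot s v z - diffQuot s (φ n) z)
      Real.HolderConjugate.two_two (by simpa using hwE) (by simpa using hsub)
    simp only [Real.rpow_two, Real.norm_eq_abs, sq_abs] at hH
    refine le_trans ?_ hH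
    rw [norm_sub_rev, ← integral_sub (integrable_gagliardoIntegrand hs0 hwE hvE)
      (integrable_gagliardoIntegrand hs0 hwE (hφE n))]
    refine (norm_integral_le_integral_norm _).trans (le_of_eq ?_)
    congr 1; ext z
    rw [← diffQuot_mul_diffQuot hs0, ← diffQuot_mul_diffQuot hs0, ← mul_sub, norm_mul,
      Real.norm_eq_abs, Real.norm_eq_abs]
  -- The identity for the test functions `φ n` is the equation for `w` combined with the weak form;
  -- both sides then pass to the limit.
  refine tendsto_nhds_unique T1 ((T2.const_mul (fracConst d s / 2)).congr fun n => ?_)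
  rw [← hwg _ (hφt n), (hφt n).integral_mul_fracLap hd hs0 hs1 hwm
    (integrable_abs_mul_of_sq hs0 hwm hw2) (integrable_gagliardoIntegrand hs0 hwE (hφE n))]

end Weight

end WeightedFracLap
end

/-! ### The integration by parts formula. -/

theorem propositionB1 (d : ℕ) (s γ₀ γ c C p : ℝ)
    (hs0 : 0 < s) (hs1 : s < 1) (hd : 2 * s < (d : ℝ))
    (hγ0 : 0 ≤ γ) (hγ1 : γ < 2 * s) (hγ2 : γ ≤ (d : ℝ) - 2 * s)
    (hγ₀0 : 0 ≤ γ₀) (hγ₀1 : γ₀ ≤ γ)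
    (ρ : WeightedFracLap.Rd d → ℝ) (hρ : WeightedFracLap.IsWeight ρ γ₀ γ c C)
    (hp0 : 2 ≤ p) (hp1 : p < 2 * ((d : ℝ) - γ) / ((d : ℝ) - 2 * s))
    (v w Lv Lw : WeightedFracLap.Rd d → ℝ)
    (hv : WeightedFracLap.MemLpWeight p ρ v) (hw : WeightedFracLap.MemLpWeight p ρ w)
    (hLv : WeightedFracLap.IsDistribFracLap s v Lv)
    (hLw : WeightedFracLap.IsDistribFracLap s w Lw)
    (hAv : WeightedFracLap.MemLpWeight (p / (p - 1)) ρ (fun x => (ρ x)⁻¹ * Lv x))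
    (hAw : WeightedFracLap.MemLpWeight (p / (p - 1)) ρ (fun x => (ρ x)⁻¹ * Lw x)) :
    WeightedFracLap.MemHdot s v ∧ WeightedFracLap.MemHdot s w ∧
    Integrable (fun x => v x * Lw x) volume ∧
    Integrable (fun x => Lv x * w x) volume ∧
    Integrable (fun z : WeightedFracLap.Rd d × WeightedFracLap.Rd d =>
      WeightedFracLap.gagliardoIntegrand s v w z.1 z.2) (volume.prod volume) ∧
    ∫ x, v x * Lw x = ∫ x, Lv x * w x ∧
    ∫ x, Lv x * w x =
      WeightedFracLap.fracConst d s / 2 *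
        ∫ x, ∫ y, WeightedFracLap.gagliardoIntegrand s v w x y := by
  have hd0 := WeightedFracLap.pos_of_two_mul_lt hs0 hd
  have hp : 1 < p := by linarith
  have hvE := (hρ.exists_test_approx_energy hγ₀0 hγ₀1 hs0 hs1 hd hγ1 hp0 hp1 hv hLv hAv).1
  have hwE := (hρ.exists_test_approx_energy hγ₀0 hγ₀1 hs0 hs1 hd hγ1 hp0 hp1 hw hLw hAw).1
  have hG := WeightedFracLap.integrable_gagliardoIntegrand hs0 hvE hwE
  -- The same identity is used with both assignments of the roles; the symmetry of the form then
  -- equates the two pairings.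
  have e1 := hρ.integral_mul_eq_gagliardo hγ₀0 hγ₀1 hs0 hs1 hd hγ1 hp0 hp1 hw hLw hAw hv hLv hAv
  have e2 := hρ.integral_mul_eq_gagliardo hγ₀0 hγ₀1 hs0 hs1 hd hγ1 hp0 hp1 hv hLv hAv hw hLw hAw
  refine ⟨hρ.memHdot hγ₀0 hγ₀1 hs0 hs1 hd hγ1 hp0 hp1 hv hLv hAv,
    hρ.memHdot hγ₀0 hγ₀1 hs0 hs1 hd hγ1 hp0 hp1 hw hLw hAw, ?_,
    hρ.integrable_mul hd0 hγ₀0 hγ₀1 hp hAv hw, hG, ?_, ?_⟩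
  · simpa only [mul_comm] using hρ.integrable_mul hd0 hγ₀0 hγ₀1 hp hAw hv
  · rw [e1]
    simp only [mul_comm (v _)]
    rw [e2]
    simp only [WeightedFracLap.gagliardoIntegrand, mul_comm (w _ - w _)]
  · rw [e1, integral_prod _ hG]
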